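/- **Parameters.** Let $N\ge 1$ be an integer, $\lambda,\beta,\rho_o,P_u,\alpha_L,\alpha_N,\theta>0$, $\sigma^2\ge 0$, let $G_b^{\max},G_b^{\min},G_u^{\max},G_u^{\min}>0$ and $\zeta_r,\zeta_t\in[0,2\pi]$. Put $\mathcal G=G_b^{\max}G_u^{\max}$ and $\eta=N(N!)^{-1/N}$, let $(a_1,a_2,a_3,a_4)=(G_b^{\max}G_u^{\max},\,G_b^{\max}G_u^{\min},\,G_b^{\min}G_u^{\max},\,G_b^{\min}G_u^{\min})$, and, with $c_r=\frac{\zeta_r}{2\pi}$, $c_t=\frac{\zeta_t}{2\pi}$, let $(b_1,b_2,b_3,b_4)=(c_rc_t,\,c_r(1-c_t),\,(1-c_r)c_t,\,(1-c_r)(1-c_t))$. **Transmit power.** Base stations form a homogeneous Poisson point process (PPP) of density $\lambda$ in $\mathbb R^2$. A link of length $r$ is LOS with probability $e^{-\beta r}$ and NLOS otherwise, independently for different links, with pathloss $r^{\alpha_L}$ or $r^{\alpha_N}$ respectively. A typical user at the origin is served by the base station of least pathloss and inverts this pathloss, with power $P=\rho_o\cdot(\text{least pathloss})$; it is active if $P\le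 P_u$ (truncated channel inversion with cutoff $\rho_o$). The law of the transmit power of an active user is the conditional law of $P$ given $P\le P_u$. **Uplink (PPP approximation).** The interferers form a homogeneous PPP of density $\lambda$ in $\mathbb R^2$, with the reference base station at the origin. Independently of each other, of their locations and of all else, they have i.i.d. transmit powers $P_z$ with the law just described, directivity gains $G_z$ with $\mathbb P(G_z=a_v)=b_v$ ($v$ running over the four entries), fading powers $|g_z|^2$ (Nakagami with parameter $N$, that is, gamma with shape $N$ and mean $1$), and a link at distance $r$ that is LOS with probability $e^{-\beta r}$ and NLOS otherwise. Let $I_L$ be the sum over the LOS interferers $u_z$ of $\mathbf 1(P_z\|u_z\|^{-\alpha_L}<\rho_o)\,P_zG_z|g_z|^2\|u_z\|^{-\alpha_L}$, let $I_N$ be the same sum over the NLOS interferers with $\alpha_N$ in place of $\alpha_L$ (both in $[0,\infty]$), and let $$\mathrm{SINR}=\frac{\rho_o|g_o|^2\mathcal G}{\sigma^2+I_L+I_N},$$ with $|g_o|^2$ gamma distributed with shape $N$ and mean $1$, independent of the interferers. Put $T=\theta(\sigma^2+I_L+I_N)/(\rho_o\mathcal G)$. **Theorem.** The transmit power of an active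 user has, on $[0,P_u]$, the density $$f_P(p)=\frac{\lambda(p)e^{-\Lambda(p)}}{\int_0^{P_u}\lambda(y)e^{-\Lambda(y)}\,dy},$$ $$\lambda(p)=\frac{2\pi\lambda}{\alpha_L\rho_o^{2/\alpha_L}}p^{\frac2{\alpha_L}-1}e^{-\beta(p/\rho_o)^{1/\alpha_L}}+\frac{2\pi\lambda}{\alpha_N\rho_o^{2/\alpha_N}}p^{\frac2{\alpha_N}-1}\bigl(1-e^{-\beta(p/\rho_o)^{1/\alpha_N}}\bigr),$$ $$\Lambda(p)=\frac{2\pi\lambda}{\beta^2}\,\kappa\bigl(\beta(p/\rho_o)^{1/\alpha_L}\bigr)+\pi\lambda(p/\rho_o)^{2/\alpha_N}-\frac{2\pi\lambda}{\beta^2}\,\kappa\bigl(\beta(p/\rho_o)^{1/\alpha_N}\bigr),\qquad \kappa(x)=1-e^{-x}(1+x).$$ The outage probability is $\mathbb P(\mathrm{SINR}<\theta)=\mathbb P(\mathrm{SINR}\le\theta)=\mathbb E[F(T)]$, where $F(t)=\mathbb P(|g_o|^2<t)$. When $F(t)$ is replaced by Alzer's approximation $(1-e^{-\eta t})^N$,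 the resulting outage probability $\mathcal O_s=\mathbb E[(1-e^{-\eta T})^N]$ equals $$\mathcal O_s=1-\sum_{n=1}^N(-1)^{n+1}\binom Nn\exp\Bigl(-\frac{\eta n\theta\sigma^2}{\rho_o\mathcal G}-Q_n-V_n\Bigr),$$ where $$Q_n=2\pi\lambda\sum_{v=1}^4 b_v\,q_v^{2/\alpha_L}\int_{\mathcal A}^\infty\!\int_0^{P_u}\mathcal F\Bigl(N,\frac{y^{-\alpha_L}}N\Bigr)e^{-\beta(q_vp)^{1/\alpha_L}y}\,y\,p^{2/\alpha_L}f_P(p)\,dp\,dy,$$ $$V_n=2\pi\lambda\sum_{v=1}^4 b_v\,q_v^{2/\alpha_N}\int_{\mathcal B}^\infty\!\int_0^{P_u}\mathcal F\Bigl(N,\frac{y^{-\alpha_N}}N\Bigr)\bigl(1-e^{-\beta(q_vp)^{1/\alpha_N}y}\bigr)\,y\,p^{2/\alpha_N}f_P(p)\,dp\,dy,$$ with $\mathcal F(N,y)=1-(1+y)^{-N}$, $q_v=\frac{\eta n\theta a_v}{\rho_o\mathcal G}$, $\mathcal A=\bigl(\frac{\eta n\theta a_v}{\mathcal G}\bigr)^{-1/\alpha_L}$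 and $\mathcal B=\bigl(\frac{\eta n\theta a_v}{\mathcal G}\bigr)^{-1/\alpha_N}$. Here $Q_n<\infty$ always and $V_n<\infty$ if $\alpha_N>2$; in general $V_n\in[0,\infty]$ and $e^{-\infty}=0$. -/

import Mathlib

open MeasureTheory ProbabilityTheory
open scoped ENNReal NNReal

noncomputable section

namespace MmWave

/-! ## Parameters -/

/-- The parameters of the single-tier network, with their ranges. -/
structure Params where
  /-- Nakagami fading parameter (a positive integer) -/
  N : ℕ
  /-- base station density -/
  lam : ℝ
  /-- blockage parameter: a link of length `r` is LOS with probability `exp (-β r)` -/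
  β : ℝ
  /-- cutoff threshold of the power control -/
  ρ₀ : ℝ
  /-- maximum transmit power of a user -/
  Pu : ℝ
  /-- LOS pathloss exponent -/
  αL : ℝ
  /-- NLOS pathloss exponent -/
  αN : ℝ
  /-- main lobe gain of a base station -/
  GbMax : ℝ
  /-- side lobe gain of a base station -/
  GbMin : ℝ
  /-- main lobe gain of a user -/
  GuMax : ℝ
  /-- side lobe gain of a user -/
  GuMin : ℝ
  /-- beamwidth of a base station -/
  ζr : ℝ
  /-- beamwidth of a user -/
  ζt : ℝ
  /-- noise power -/
  σsq : ℝ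
  /-- target SINR -/
  θ : ℝ
  N_pos : 1 ≤ N
  lam_pos : 0 < lam
  β_pos : 0 < β
  ρ₀_pos : 0 < ρ₀
  Pu_pos : 0 < Pu
  αL_pos : 0 < αL
  αN_pos : 0 < αN
  GbMax_pos : 0 < GbMax
  GbMin_pos : 0 < GbMin
  GuMax_pos : 0 < GuMax
  GuMin_pos : 0 < GuMin
  ζr_mem : ζr ∈ Set.Icc 0 (2 * Real.pi)
  ζt_mem : ζt ∈ Set.Icc 0 (2 * Real.pi)
  σsq_nonneg : 0 ≤ σsq
  θ_pos : 0 < θ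

/-- The plane `ℝ²`. -/
abbrev Plane : Type := EuclideanSpace ℝ (Fin 2)

/-! ## Homogeneous Poisson point processes in the plane -/

section PPP

variable {Ω : Type*}

/-- The number of points of the enumerated point process `X 0, X 1, …` in the set `B`. -/
def count (X : ℕ → Ω → Plane) (B : Set Plane) (ω : Ω) : ℝ≥0∞ :=
  ∑' i, B.indicator (fun _ => (1 : ℝ≥0∞)) (X i ω)

/-- `X 0, X 1, …` enumerates the points of a homogeneous Poisson point process in the plane
with density `lam`: the number of points in a Borel set `B` of finite area is Poisson
distributed with mean `lam * area B`, and the numbers of points in disjoint Borel sets are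
independent. -/
structure IsPoissonProcess [MeasurableSpace Ω] (X : ℕ → Ω → Plane) (lam : ℝ)
    (μ : Measure Ω) : Prop where
  measurable : ∀ i, Measurable (X i)
  count_law : ∀ B : Set Plane, MeasurableSet B → volume B ≠ ∞ →
    HasLaw (count X B)
      ((poissonMeasure (lam.toNNReal * (volume B).toNNReal)).map (fun k : ℕ => (k : ℝ≥0∞))) μ
  count_indep : ∀ (m : ℕ) (B : Fin m → Set Plane), (∀ j, MeasurableSet (B j)) →
    (∀ j k, j ≠ k → Disjoint (B j) (B k)) → iIndepFun (fun j => count X (B j)) μ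

end PPP

/-- The uniform distribution on `[0, 1]`. -/
def unifLaw : Measure ℝ := volume.restrict (Set.Icc 0 1)

/-- `e^{-x}` for `x ∈ [0, ∞]`, with `e^{-∞} = 0`. -/
def expNeg (x : ℝ≥0∞) : ℝ := if x = ∞ then 0 else Real.exp (-x.toReal)

namespace Params

variable (S : Params)

/-! ## Transmit power of a typical user -/

section TypicalUser

variable {Ω₀ : Type*}

/-- The pathloss of the link between the typical user (at the origin) and the `i`-th base
station: the base stations are at `Y 0, Y 1, …`, and the link to the `i`-th one is LOS if
`V i ≤ exp (-β ‖Y i‖)`, where `V i` is uniform on `[0, 1]`. -/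
def pathloss (Y : ℕ → Ω₀ → Plane) (V : ℕ → Ω₀ → ℝ) (i : ℕ) (ω : Ω₀) : ℝ :=
  if V i ω ≤ Real.exp (-S.β * ‖Y i ω‖) then ‖Y i ω‖ ^ S.αL else ‖Y i ω‖ ^ S.αN

/-- The power that inverts the pathloss to the serving base station, which is the one with the
least pathloss, up to an average received power of `ρ₀`. -/
def inversionPower (Y : ℕ → Ω₀ → Plane) (V : ℕ → Ω₀ → ℝ) (ω : Ω₀) : ℝ :=
  S.ρ₀ * ⨅ i, S.pathloss Y V i ω

/-- The network of base stations seen from a typical user: a homogeneous Poisson process of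
base stations with density `lam`, the links to them being LOS or NLOS independently of each
other given the base stations. -/
structure IsBSNetwork [MeasurableSpace Ω₀] (Y : ℕ → Ω₀ → Plane) (V : ℕ → Ω₀ → ℝ)
    (μ₀ : Measure Ω₀) : Prop where
  poisson : IsPoissonProcess Y S.lam μ₀
  mark_measurable : ∀ i, Measurable (V i)
  mark_law : ∀ i, HasLaw (V i) unifLaw μ₀
  mark_indep : iIndepFun V μ₀
  indep : IndepFun (fun ω i => Y i ω) (fun ω i => V i ω) μ₀

/-- The distribution of the transmit power of a typical active user under truncated channel
inversion: the conditional law of the pathloss-inverting power, given that it does not exceed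
the maximum power `Pu`. -/
def powerLaw [MeasurableSpace Ω₀] (Y : ℕ → Ω₀ → Plane) (V : ℕ → Ω₀ → ℝ)
    (μ₀ : Measure Ω₀) : Measure ℝ :=
  (cond μ₀ {ω | S.inversionPower Y V ω ≤ S.Pu}).map (S.inversionPower Y V)

end TypicalUser

/-- The intensity `λ(p)`. -/
def intensity (p : ℝ) : ℝ :=
  2 * Real.pi * S.lam / (S.αL * S.ρ₀ ^ (2 / S.αL)) * p ^ (2 / S.αL - 1)
      * Real.exp (-S.β * (p / S.ρ₀) ^ (1 / S.αL))
    + 2 * Real.pi * S.lam / (S.αN * S.ρ₀ ^ (2 / S.αN)) * p ^ (2 / S.αN - 1)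
      * (1 - Real.exp (-S.β * (p / S.ρ₀) ^ (1 / S.αN)))

/-- The cumulative intensity `Λ(p)`. -/
def cumIntensity (p : ℝ) : ℝ :=
  2 * Real.pi * S.lam / S.β ^ 2
      * (1 - Real.exp (-S.β * (p / S.ρ₀) ^ (1 / S.αL)) * (1 + S.β * (p / S.ρ₀) ^ (1 / S.αL)))
    + Real.pi * S.lam * (p / S.ρ₀) ^ (2 / S.αN)
    - 2 * Real.pi * S.lam / S.β ^ 2
      * (1 - Real.exp (-S.β * (p / S.ρ₀) ^ (1 / S.αN)) * (1 + S.β * (p / S.ρ₀) ^ (1 / S.αN)))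

/-- The function `f_P(p)`, for `0 ≤ p ≤ Pu`. -/
def fP (p : ℝ) : ℝ :=
  S.intensity p * Real.exp (-S.cumIntensity p)
    / ∫ y in (0 : ℝ)..S.Pu, S.intensity y * Real.exp (-S.cumIntensity y)

/-! ## Directivity gains and fading -/

/-- The directivity gain `𝒢` of the desired link. -/
def gain : ℝ := S.GbMax * S.GuMax

/-- The values `a_v` of the directivity gain of an interfering link. -/
def a : Fin 4 → ℝ :=
  ![S.GbMax * S.GuMax, S.GbMax * S.GuMin, S.GbMin * S.GuMax, S.GbMin * S.GuMin]

/-- The probabilities `b_v` of the values `a_v`. -/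
def b : Fin 4 → ℝ :=
  ![S.ζr * S.ζt / (4 * Real.pi ^ 2),
    S.ζr / (2 * Real.pi) * (1 - S.ζt / (2 * Real.pi)),
    (1 - S.ζr / (2 * Real.pi)) * (S.ζt / (2 * Real.pi)),
    (1 - S.ζr / (2 * Real.pi)) * (1 - S.ζt / (2 * Real.pi))]

/-- The distribution of the directivity gain of an interfering link. -/
def gainLaw : Measure ℝ := ∑ v, ENNReal.ofReal (S.b v) • Measure.dirac (S.a v)

/-- The distribution of the power `|g|²` of Nakagami fading `g` with parameter `N`: the
normalized (mean one) gamma distribution with parameter `N`. -/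
def fadingLaw : Measure ℝ := gammaMeasure S.N S.N

/-! ## The uplink at the reference base station -/

section Uplink

variable {Ω : Type*}

/-- The marks of an interferer: a uniform variable which decides whether its link to the
reference base station is LOS, its transmit power, the directivity gain of the link, and the
fading power of the link. -/
structure Marks (Ω : Type*) where
  /-- decides between LOS and NLOS -/
  U : ℕ → Ω → ℝ
  /-- transmit powers -/
  P : ℕ → Ω → ℝ
  /-- directivity gains -/
  G : ℕ → Ω → ℝ
  /-- fading powers `|g_z|²` -/
  H : ℕ → Ω → ℝ

/-- All marks of the `i`-th interferer. -/
def Marks.tuple (M : Marks Ω) (i : ℕ) (ω : Ω) : ℝ × ℝ × ℝ × ℝ :=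
  (M.U i ω, M.P i ω, M.G i ω, M.H i ω)

/-- The interference model: the interferers `X 0, X 1, …` form a homogeneous Poisson process
with density `lam` (one user per base station); their marks are i.i.d. with independent
components and independent of the locations; the fading power `h₀` of the desired link is
independent of all that. Here `π` is the distribution of the transmit power of an active user.
The reference base station is at the origin. -/
structure IsUplink [MeasurableSpace Ω] (π : Measure ℝ) (h₀ : Ω → ℝ) (X : ℕ → Ω → Plane)
    (M : Marks Ω) (μ : Measure Ω) : Prop where
  desired_measurable : Measurable h₀
  desired_law : HasLaw h₀ S.fadingLaw μ
  poisson : IsPoissonProcess X S.lam μ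
  mark_measurable : ∀ i, Measurable (M.tuple i)
  mark_law : ∀ i, HasLaw (M.tuple i) (unifLaw.prod (π.prod (S.gainLaw.prod S.fadingLaw))) μ
  mark_indep : iIndepFun M.tuple μ
  indep : IndepFun (fun ω i => X i ω) (fun ω i => M.tuple i ω) μ
  desired_indep : IndepFun h₀ (fun ω => ((fun i => X i ω), (fun i => M.tuple i ω))) μ

/-- The link from the `i`-th interferer to the reference base station is LOS. -/
def IsLOS (X : ℕ → Ω → Plane) (M : Marks Ω) (i : ℕ) (ω : Ω) : Prop :=
  M.U i ω ≤ Real.exp (-S.β * ‖X i ω‖)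

open Classical in
/-- The interference power from the LOS interferers. An interferer served by another base
station is received (before gains and fading) with an average power less than `ρ₀`. -/
def interferenceLOS (X : ℕ → Ω → Plane) (M : Marks Ω) (ω : Ω) : ℝ≥0∞ :=
  ∑' i, if S.IsLOS X M i ω ∧ M.P i ω * ‖X i ω‖ ^ (-S.αL) < S.ρ₀ then
    ENNReal.ofReal (M.P i ω * M.G i ω * M.H i ω * ‖X i ω‖ ^ (-S.αL)) else 0

open Classical in
/-- The interference power from the NLOS interferers. -/
def interferenceNLOS (X : ℕ → Ω → Plane) (M : Marks Ω) (ω : Ω) : ℝ≥0∞ :=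
  ∑' i, if ¬ S.IsLOS X M i ω ∧ M.P i ω * ‖X i ω‖ ^ (-S.αN) < S.ρ₀ then
    ENNReal.ofReal (M.P i ω * M.G i ω * M.H i ω * ‖X i ω‖ ^ (-S.αN)) else 0

/-- Noise plus interference. -/
def disturbance (X : ℕ → Ω → Plane) (M : Marks Ω) (ω : Ω) : ℝ≥0∞ :=
  ENNReal.ofReal S.σsq + S.interferenceLOS X M ω + S.interferenceNLOS X M ω

/-- The SINR at the reference base station. -/
def SINR (h₀ : Ω → ℝ) (X : ℕ → Ω → Plane) (M : Marks Ω) (ω : Ω) : ℝ≥0∞ :=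
  ENNReal.ofReal (S.ρ₀ * h₀ ω * S.gain) / S.disturbance X M ω

/-- The level `θ (σ² + I_L + I_N) / (ρ₀ 𝒢)` below which the fading power of the desired link
causes an outage. -/
def level (X : ℕ → Ω → Plane) (M : Marks Ω) (ω : Ω) : ℝ≥0∞ :=
  ENNReal.ofReal (S.θ / (S.ρ₀ * S.gain)) * S.disturbance X M ω

/-- The outage probability that results when the distribution function of the fading power of
the desired link is `F`. -/
def outage [MeasurableSpace Ω] (F : ℝ≥0∞ → ℝ) (X : ℕ → Ω → Plane) (M : Marks Ω)
    (μ : Measure Ω) : ℝ :=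
  ∫ ω, F (S.level X M ω) ∂μ

end Uplink

/-- The exact probability that the fading power is less than `t`. -/
def fadingCDF (t : ℝ≥0∞) : ℝ := S.fadingLaw.real {x | ENNReal.ofReal x < t}

/-- The constant `η = N (N!)^{-1/N}`. -/
def eta : ℝ := S.N * (S.N.factorial : ℝ) ^ (-1 / (S.N : ℝ))

/-- Alzer's expression `(1 - e^{-η t})^N`, which replaces the exact distribution function of
the fading power. -/
def alzerCDF (t : ℝ≥0∞) : ℝ := (1 - expNeg (ENNReal.ofReal S.eta * t)) ^ S.N

/-! ## The analytical expression -/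

/-- The function `ℱ(N, y) = 1 - 1 / (1 + y)^N`. -/
def calF (N : ℕ) (y : ℝ) : ℝ := 1 - 1 / (1 + y) ^ N

/-- `q_v = η n θ a_v / (ρ₀ 𝒢)`. -/
def q (n : ℕ) (v : Fin 4) : ℝ := S.eta * n * S.θ * S.a v / (S.ρ₀ * S.gain)

/-- `𝒜 = (η n θ a_v / 𝒢)^{-1/α_L}`. -/
def calA (n : ℕ) (v : Fin 4) : ℝ := (S.eta * n * S.θ * S.a v / S.gain) ^ (-1 / S.αL)

/-- `ℬ = (η n θ a_v / 𝒢)^{-1/α_N}`. -/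
def calB (n : ℕ) (v : Fin 4) : ℝ := (S.eta * n * S.θ * S.a v / S.gain) ^ (-1 / S.αN)

/-- The term `Q_n` of the LOS interferers, an element of `[0, ∞]`. -/
def Q (n : ℕ) : ℝ≥0∞ :=
  ENNReal.ofReal (2 * Real.pi * S.lam) * ∑ v,
    ENNReal.ofReal (S.b v * S.q n v ^ (2 / S.αL)) *
      ∫⁻ y in Set.Ioi (S.calA n v), ∫⁻ p in Set.Icc 0 S.Pu,
        ENNReal.ofReal (calF S.N (y ^ (-S.αL) / S.N)
          * Real.exp (-S.β * (S.q n v * p) ^ (1 / S.αL) * y)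
          * y * p ^ (2 / S.αL) * S.fP p)

/-- The term `V_n` of the NLOS interferers, an element of `[0, ∞]`. -/
def V (n : ℕ) : ℝ≥0∞ :=
  ENNReal.ofReal (2 * Real.pi * S.lam) * ∑ v,
    ENNReal.ofReal (S.b v * S.q n v ^ (2 / S.αN)) *
      ∫⁻ y in Set.Ioi (S.calB n v), ∫⁻ p in Set.Icc 0 S.Pu,
        ENNReal.ofReal (calF S.N (y ^ (-S.αN) / S.N)
          * (1 - Real.exp (-S.β * (S.q n v * p) ^ (1 / S.αN) * y))
          * y * p ^ (2 / S.αN) * S.fP p)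

end Params

end MmWave

end

/-!
Everything rests on the Laplace functional of an independently marked Poisson process of density
`λ`, `E e^{-Σ f(Xᵢ, mᵢ)} = exp (-λ ∫ E (1 - e^{-f(x, m)}) dx)`
(`IsPoissonProcess.lintegral_eexp_tsum_marked`). For an unmarked process and a function with
finitely many values it follows from the independent Poisson counts, and monotone limits give all
functions with values in `[0, ∞]`. Marks are averaged out given the points: their mean
`h(x) = E e^{-f(x, m)}` replaces `e^{-f}`, so the unmarked formula applies to `-log h`.

*Transmit power.* The power is at least `p` if no base station has pathloss less than `p / ρ₀`.
This void probability is the Laplace functional of a function with values in `{0, ∞}`; in polar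
coordinates it is `e^{-Λ(p)}`. As `Λ' = λ`, the power has the density `λ e^{-Λ}`, and conditioning
on `P ≤ Pu` normalizes it (`Params.powerLaw_eq_withDensity`).

*Exact outage.* Almost surely the fading power `|g_o|²` is positive, and then `SINR < θ` says
that it is less than `T`; it is independent of `T`, and its law has no atoms
(`Params.measureReal_SINR_lt`, `Params.measureReal_SINR_le`).

*Alzer's approximation.* The binomial theorem reduces `E (1 - e^{-η T})^N` to the Laplace
transforms `E e^{-n η T}`. The Laplace functional expresses them by the mean of `1 - e^{-s J}` over
the marks, where `J` is the contribution of an interferer and `s = η n θ / (ρ₀ 𝒢)`; the gamma law of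
the fading turns it into `ℱ`. The substitution `r = (q_v p)^{1/α} y`
(`Params.lintegral_radial_substitution`) and Tonelli's theorem produce `Q_n` and `V_n`.

*Finiteness.* Before the substitution, `Q_n` is bounded by a multiple of `∫ r e^{-β r} dr`; and
`V_n` is bounded by a multiple of `∫ y^{1 - α_N} dy` over a half-line away from `0`, as
`ℱ(N, y/N) ≤ y`.
-/

open Filter Topology

namespace MmWave

/-! ### The exponential `e^{-x}` on `[0, ∞]` -/

/-- The function `x ↦ e^{-x}` from `[0, ∞]` to `[0, ∞]`. It is `expNeg` with extended values, in
which form it fits the Lebesgue integral of functions with values in `[0, ∞]`. -/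
noncomputable def eexp (x : ℝ≥0∞) : ℝ≥0∞ := EReal.exp (-(x : EReal))

lemma eexp_eq_ofReal_expNeg (x : ℝ≥0∞) : eexp x = ENNReal.ofReal (expNeg x) := by
  induction x with
  | top => simp [eexp, expNeg]
  | coe x =>
    rw [eexp, expNeg, if_neg ENNReal.coe_ne_top]
    have : (-(((x : ℝ≥0∞)) : EReal)) = ((-(x : ℝ) : ℝ) : EReal) := rfl
    rw [this, EReal.exp_coe]
    rfl

lemma expNeg_nonneg (x : ℝ≥0∞) : 0 ≤ expNeg x := by
  unfold expNeg
  split_ifs <;> positivity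

lemma toReal_eexp (x : ℝ≥0∞) : (eexp x).toReal = expNeg x := by
  rw [eexp_eq_ofReal_expNeg, ENNReal.toReal_ofReal (expNeg_nonneg x)]

@[simp] lemma eexp_zero : eexp 0 = 1 := by simp [eexp]

@[simp] lemma eexp_top : eexp ∞ = 0 := by simp [eexp]

lemma eexp_ofReal {x : ℝ} (hx : 0 ≤ x) :
    eexp (ENNReal.ofReal x) = ENNReal.ofReal (Real.exp (-x)) := by
  rw [eexp_eq_ofReal_expNeg, expNeg, if_neg ENNReal.ofReal_ne_top, ENNReal.toReal_ofReal hx]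

lemma continuous_eexp : Continuous eexp :=
  ENNReal.continuous_exp.comp (continuous_neg.comp continuous_coe_ennreal_ereal)

lemma measurable_eexp : Measurable eexp := continuous_eexp.measurable

lemma antitone_eexp : Antitone eexp := fun _ _ h =>
  EReal.exp_monotone (EReal.neg_le_neg_iff.2 (EReal.coe_ennreal_le_coe_ennreal_iff.2 h))

lemma eexp_le_one (x : ℝ≥0∞) : eexp x ≤ 1 := eexp_zero ▸ antitone_eexp bot_le

lemma eexp_add (x y : ℝ≥0∞) : eexp (x + y) = eexp x * eexp y := by
  rw [eexp, EReal.coe_ennreal_add, EReal.neg_add (by simp) (by simp), sub_eq_add_neg,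
    EReal.exp_add, eexp, eexp]

lemma eexp_sum {ι : Type*} (s : Finset ι) (f : ι → ℝ≥0∞) :
    eexp (∑ i ∈ s, f i) = ∏ i ∈ s, eexp (f i) := by
  classical
  induction s using Finset.induction_on with
  | empty => simp
  | insert a s ha ih => rw [Finset.sum_insert ha, Finset.prod_insert ha, eexp_add, ih]

lemma eexp_natCast_mul (k : ℕ) (x : ℝ≥0∞) : eexp (k * x) = eexp x ^ k := by
  have := eexp_sum (Finset.range k) (fun _ => x)
  simpa using this

/-- The inverse function `h ↦ -log h` of `eexp`. -/
noncomputable def neglog (h : ℝ≥0∞) : ℝ≥0∞ := (-ENNReal.log h).toENNReal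

lemma eexp_neglog {h : ℝ≥0∞} (hh : h ≤ 1) : eexp (neglog h) = h := by
  have h0 : ENNReal.log h ≤ 0 := by
    simpa using ENNReal.log_monotone hh
  rw [eexp, neglog, EReal.coe_toENNReal (by simpa using EReal.neg_le_neg_iff.2 h0), neg_neg,
    ENNReal.exp_log]

lemma measurable_neglog : Measurable neglog :=
  (ENNReal.measurable_log.neg).ereal_toENNReal

/-- `e^{-Σ aᵢ}` is the limit of the finite products of the `e^{-aᵢ}`. -/
lemma tendsto_prod_eexp (a : ℕ → ℝ≥0∞) :
    Tendsto (fun n => ∏ i ∈ Finset.range n, eexp (a i)) atTop (𝓝 (eexp (∑' i, a i))) := by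
  have := (continuous_eexp.tendsto _).comp (ENNReal.summable (f := a)).hasSum.tendsto_sum_nat
  exact this.congr fun n => eexp_sum _ _

/-! ### The Laplace functional of a Poisson process -/

lemma lintegral_eexp_mul_poissonMeasure (r : ℝ≥0) (c : ℝ≥0∞) :
    ∫⁻ k : ℕ, eexp (c * k) ∂(poissonMeasure r) = eexp (r * (1 - eexp c)) := by
  have hle : eexp c ≤ 1 := eexp_le_one c
  obtain ⟨z, hz⟩ : ∃ z : ℝ≥0, eexp c = z :=
    ⟨(eexp c).toNNReal, (ENNReal.coe_toNNReal (hle.trans_lt ENNReal.one_lt_top).ne).symm⟩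
  have hz1 : (z : ℝ) ≤ 1 := by
    have : (z : ℝ≥0∞) ≤ 1 := hz ▸ hle
    exact_mod_cast this
  have h1 : (r : ℝ≥0∞) * (1 - eexp c) = ENNReal.ofReal (r * (1 - z)) := by
    rw [hz, ENNReal.ofReal_mul r.coe_nonneg, ENNReal.ofReal_sub _ z.coe_nonneg]
    simp
  have hs : HasSum (fun n : ℕ => Real.exp (-r) * (((r : ℝ) * z) ^ n / (n.factorial : ℝ)))
      (Real.exp (-r) * Real.exp (r * z)) := by
    have := (NormedSpace.expSeries_div_hasSum_exp ((r : ℝ) * z)).mul_left (Real.exp (-r))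
    simpa [← Real.exp_eq_exp_ℝ] using this
  rw [poissonMeasure, lintegral_sum_measure, h1, eexp_ofReal (by
    exact mul_nonneg r.coe_nonneg (by linarith))]
  have hterm : ∀ n : ℕ, ∫⁻ k : ℕ, eexp (c * k) ∂(ENNReal.ofReal
      (Real.exp (-r) * r ^ n / n.factorial) • Measure.dirac n)
      = ENNReal.ofReal (Real.exp (-r) * (((r : ℝ) * z) ^ n / (n.factorial : ℝ))) := by
    intro n
    rw [lintegral_smul_measure, lintegral_dirac, mul_comm c, eexp_natCast_mul, hz, smul_eq_mul,
      ← ENNReal.ofReal_coe_nnreal, ← ENNReal.ofReal_pow z.coe_nonneg,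
      ← ENNReal.ofReal_mul (by positivity)]
    congr 1
    rw [mul_pow]
    ring
  simp_rw [hterm]
  rw [← ENNReal.ofReal_tsum_of_nonneg (fun n => by positivity) hs.summable, hs.tsum_eq,
    ← Real.exp_add]
  congr 2
  ring

variable {Ω : Type*} [MeasurableSpace Ω] {μ : Measure Ω}

lemma measurable_count {X : ℕ → Ω → Plane} (hX : ∀ i, Measurable (X i)) {B : Set Plane}
    (hB : MeasurableSet B) : Measurable (count X B) :=
  Measurable.tsum fun i => (measurable_const.indicator hB).comp (hX i)

/-- The Laplace functional of a Poisson process at a function with finitely many values: there it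
only involves the independent Poisson distributed numbers of points in disjoint sets. -/
lemma IsPoissonProcess.lintegral_eexp_sum_count {X : ℕ → Ω → Plane} {lam : ℝ}
    (hX : IsPoissonProcess X lam μ) {m : ℕ} (B : Fin m → Set Plane)
    (hB : ∀ j, MeasurableSet (B j)) (hfin : ∀ j, volume (B j) ≠ ∞)
    (hdisj : ∀ j k, j ≠ k → Disjoint (B j) (B k)) (c : Fin m → ℝ≥0∞) :
    ∫⁻ ω, eexp (∑ j, c j * count X (B j) ω) ∂μ
      = eexp (ENNReal.ofReal lam * ∑ j, (1 - eexp (c j)) * volume (B j)) := by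
  have hind := hX.count_indep m B hB hdisj
  have hm : ∀ j : Fin m, Measurable (fun k : ℝ≥0∞ => eexp (c j * k)) := fun j =>
    measurable_eexp.comp (measurable_id.const_mul _)
  simp_rw [eexp_sum]
  rw [lintegral_prod_eq_prod_lintegral_of_indepFun Finset.univ
    (fun j ω => eexp (c j * count X (B j) ω)) (hind.comp (fun j k => eexp (c j * k)) hm)
    (fun j => (hm j).comp (measurable_count hX.measurable (hB j))), Finset.mul_sum, eexp_sum]
  refine Finset.prod_congr rfl fun j _ => ?_
  rw [(hX.count_law (B j) (hB j) (hfin j)).lintegral_comp (hm j).aemeasurable,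
    lintegral_map (hm j) (by fun_prop), lintegral_eexp_mul_poissonMeasure, ENNReal.coe_mul,
    ENNReal.coe_toNNReal (hfin j), ENNReal.ofReal, mul_assoc, mul_comm (volume (B j))]

/-- The Laplace functional of a Poisson process at a simple function, restricted to a set of
finite area. -/
lemma IsPoissonProcess.lintegral_eexp_tsum_simpleFunc {X : ℕ → Ω → Plane} {lam : ℝ}
    (hX : IsPoissonProcess X lam μ) (g : SimpleFunc Plane ℝ≥0∞) {D : Set Plane}
    (hD : MeasurableSet D) (hfin : volume D ≠ ∞) :
    ∫⁻ ω, eexp (∑' i, D.indicator g (X i ω)) ∂μ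
      = eexp (ENNReal.ofReal lam * ∫⁻ x, (1 - eexp (D.indicator g x))) := by
  let e := g.range.equivFin
  let c : Fin g.range.card → ℝ≥0∞ := fun j => (e.symm j : ℝ≥0∞)
  let B : Fin g.range.card → Set Plane := fun j => g ⁻¹' {c j} ∩ D
  have hB : ∀ j, MeasurableSet (B j) := fun j => (g.measurableSet_fiber _).inter hD
  -- a function of the value of `g`, written in terms of the sets `B j`
  have key : ∀ (φ : ℝ≥0∞ → ℝ≥0∞), φ 0 = 0 → ∀ x, φ (D.indicator g x)
      = ∑ j, φ (c j) * (B j).indicator (fun _ => (1 : ℝ≥0∞)) x := by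
    intro φ hφ x
    by_cases hx : x ∈ D
    · rw [Set.indicator_of_mem hx, Finset.sum_eq_single (e ⟨g x, g.mem_range_self x⟩)]
      · have hc : c (e ⟨g x, g.mem_range_self x⟩) = g x := by simp [c]
        have hxB : x ∈ B (e ⟨g x, g.mem_range_self x⟩) := ⟨by simp [hc], hx⟩
        rw [Set.indicator_of_mem hxB, hc, mul_one]
      · intro j _ hj
        rw [Set.indicator_of_notMem, mul_zero]
        rintro ⟨h, -⟩
        apply hj
        rw [← Equiv.symm_apply_eq]
        exact Subtype.ext (h : g x = c j).symm
      · simp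
    · rw [Set.indicator_of_notMem hx, hφ]
      refine (Finset.sum_eq_zero fun j _ => ?_).symm
      rw [Set.indicator_of_notMem (fun h => hx h.2), mul_zero]
  have h1 : ∀ ω, ∑' i, D.indicator g (X i ω) = ∑ j, c j * count X (B j) ω := by
    intro ω
    simp_rw [count, ← ENNReal.tsum_mul_left]
    rw [← Summable.tsum_finsetSum (fun _ _ => ENNReal.summable)]
    exact tsum_congr fun i => key id rfl _
  have h2 : ∫⁻ x, (1 - eexp (D.indicator g x)) = ∑ j, (1 - eexp (c j)) * volume (B j) := by
    simp_rw [key (fun y => 1 - eexp y) (by simp)]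
    rw [lintegral_finsetSum _ fun j _ =>
      (measurable_const.indicator (hB j)).const_mul _]
    refine Finset.sum_congr rfl fun j _ => ?_
    rw [lintegral_const_mul _ (measurable_const.indicator (hB j)), lintegral_indicator (hB j),
      setLIntegral_one]
  simp_rw [h1]
  rw [h2]
  refine hX.lintegral_eexp_sum_count B hB
    (fun j => (measure_mono_top Set.inter_subset_right).mt hfin) (fun j k hjk => ?_) c
  refine Set.disjoint_left.2 fun x hx hx' => hjk ?_
  exact e.symm.injective (Subtype.ext ((hx.1 : g x = c j).symm.trans (hx'.1 : g x = c k)))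

/-- The Laplace functional of a Poisson process:
`E e^{-Σ f(Xᵢ)} = exp (-λ ∫ (1 - e^{-f(x)}) dx)`. -/
theorem IsPoissonProcess.lintegral_eexp_tsum [IsProbabilityMeasure μ] {X : ℕ → Ω → Plane}
    {lam : ℝ} (hX : IsPoissonProcess X lam μ) {f : Plane → ℝ≥0∞} (hf : Measurable f) :
    ∫⁻ ω, eexp (∑' i, f (X i ω)) ∂μ = eexp (ENNReal.ofReal lam * ∫⁻ x, (1 - eexp (f x))) := by
  let F : ℕ → Plane → ℝ≥0∞ := fun n => (Metric.ball 0 n).indicator (SimpleFunc.eapprox f n)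
  have hF : ∀ n, Measurable (F n) := fun n =>
    (SimpleFunc.measurable _).indicator measurableSet_ball
  have hmono : Monotone F := by
    intro n m hnm x
    have hsub : Metric.ball (0 : Plane) n ⊆ Metric.ball 0 m :=
      Metric.ball_subset_ball (by exact_mod_cast hnm)
    refine (Set.indicator_le_indicator_of_subset hsub (fun _ => bot_le) x).trans ?_
    exact Set.indicator_le_indicator (SimpleFunc.monotone_eapprox f hnm x)
  have hlim : ∀ x, Tendsto (fun n => F n x) atTop (𝓝 (f x)) := by
    intro x
    have h1 : Tendsto (fun n => SimpleFunc.eapprox f n x) atTop (𝓝 (f x)) := by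
      rw [← SimpleFunc.iSup_eapprox_apply hf x]
      exact tendsto_atTop_iSup fun n m h => SimpleFunc.monotone_eapprox f h x
    refine h1.congr' ?_
    obtain ⟨k, hk⟩ := exists_nat_gt ‖x‖
    filter_upwards [eventually_ge_atTop k] with n hn
    have hxn : x ∈ Metric.ball (0 : Plane) n :=
      mem_ball_zero_iff.2 (hk.trans_le (by exact_mod_cast hn))
    exact (Set.indicator_of_mem hxn _).symm
  have hsum : ∀ ω, Tendsto (fun n => ∑' i, F n (X i ω)) atTop (𝓝 (∑' i, f (X i ω))) := by
    intro ω
    simp_rw [← lintegral_count]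
    exact lintegral_tendsto_of_tendsto_of_monotone
      (fun n => (Measurable.of_discrete).aemeasurable)
      (ae_of_all _ fun i n m h => hmono h _) (ae_of_all _ fun i => hlim _)
  have hL : Tendsto (fun n => ∫⁻ ω, eexp (∑' i, F n (X i ω)) ∂μ) atTop
      (𝓝 (∫⁻ ω, eexp (∑' i, f (X i ω)) ∂μ)) := by
    refine tendsto_lintegral_of_dominated_convergence (fun _ => 1) (fun n => ?_)
      (fun n => ae_of_all _ fun ω => eexp_le_one _) (by simp)
      (ae_of_all _ fun ω => (continuous_eexp.tendsto _).comp (hsum ω))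
    exact measurable_eexp.comp (Measurable.tsum fun i => (hF n).comp (hX.measurable i))
  have hsub : Monotone fun y : ℝ≥0∞ => 1 - eexp y := fun x y h =>
    tsub_le_tsub_left (antitone_eexp h) _
  have hcont : Continuous fun y : ℝ≥0∞ => 1 - eexp y :=
    (ENNReal.continuous_sub_left ENNReal.one_ne_top).comp continuous_eexp
  have hI : Tendsto (fun n => ∫⁻ x, (1 - eexp (F n x))) atTop (𝓝 (∫⁻ x, (1 - eexp (f x)))) :=
    lintegral_tendsto_of_tendsto_of_monotone
      (fun n => (hcont.measurable.comp (hF n)).aemeasurable)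
      (ae_of_all _ fun x n m h => hsub (hmono h x))
      (ae_of_all _ fun x => (hcont.tendsto _).comp (hlim x))
  have hR := (continuous_eexp.tendsto _).comp
    (ENNReal.Tendsto.const_mul hI (Or.inr (ENNReal.ofReal_ne_top (r := lam))))
  refine tendsto_nhds_unique hL (hR.congr fun n => ?_)
  exact (hX.lintegral_eexp_tsum_simpleFunc _ measurableSet_ball measure_ball_lt_top.ne).symm

/-- The Laplace functional of an independently marked Poisson process. Given the points, the
expectation over the marks replaces `e^{-f(x)}` by its mean `h(x)` over the mark of the point `x`,
and `h = e^{-(-log h)}` is a case of the Laplace functional of the unmarked process. -/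
theorem IsPoissonProcess.lintegral_eexp_tsum_marked [IsProbabilityMeasure μ]
    {X : ℕ → Ω → Plane} {lam : ℝ} (hX : IsPoissonProcess X lam μ)
    {E : Type*} [MeasurableSpace E] {m : ℕ → Ω → E} {ν : Measure E}
    (hm : ∀ i, Measurable (m i)) (hlaw : ∀ i, HasLaw (m i) ν μ) (hmi : iIndepFun m μ)
    (hXm : IndepFun (fun ω i => X i ω) (fun ω i => m i ω) μ)
    {f : Plane → E → ℝ≥0∞} (hf : Measurable (Function.uncurry f)) :
    ∫⁻ ω, eexp (∑' i, f (X i ω) (m i ω)) ∂μ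
      = eexp (ENNReal.ofReal lam * ∫⁻ x, ∫⁻ z, (1 - eexp (f x z)) ∂ν) := by
  have hν : IsProbabilityMeasure ν := (hlaw 0).isProbabilityMeasure_iff.1 inferInstance
  let h : Plane → ℝ≥0∞ := fun x => ∫⁻ z, eexp (f x z) ∂ν
  have hef : Measurable (Function.uncurry fun x z => eexp (f x z)) := measurable_eexp.comp hf
  have hh : Measurable h := hef.lintegral_prod_right'
  have hh1 : ∀ x, h x ≤ 1 := fun x =>
    (lintegral_mono fun z => eexp_le_one _).trans (by simp)
  have hXm' : Measurable fun ω i => X i ω := measurable_pi_lambda _ hX.measurable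
  have hmm' : Measurable fun ω i => m i ω := measurable_pi_lambda _ hm
  have hfi : ∀ (x : Plane), Measurable (f x) := fun x => hf.of_uncurry_left
  -- the expectation over the marks, for given points
  have hinner : ∀ x : ℕ → Plane,
      ∫⁻ ω, eexp (∑' i, f (x i) (m i ω)) ∂μ = eexp (∑' i, neglog (h (x i))) := by
    intro x
    have h1 : Tendsto (fun n => ∫⁻ ω, ∏ i ∈ Finset.range n, eexp (f (x i) (m i ω)) ∂μ) atTop
        (𝓝 (∫⁻ ω, eexp (∑' i, f (x i) (m i ω)) ∂μ)) := by
      refine tendsto_lintegral_of_dominated_convergence (fun _ => 1) (fun n => ?_)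
        (fun n => ae_of_all _ fun ω => Finset.prod_le_one' fun i _ => eexp_le_one _) (by simp)
        (ae_of_all _ fun ω => tendsto_prod_eexp _)
      exact Finset.measurable_prod _ fun i _ =>
        measurable_eexp.comp ((hfi _).comp (hm i))
    refine tendsto_nhds_unique h1 ((tendsto_prod_eexp fun i => neglog (h (x i))).congr fun n => ?_)
    have hg : ∀ i, Measurable fun z => eexp (f (x i) z) := fun i => measurable_eexp.comp (hfi _)
    rw [lintegral_prod_eq_prod_lintegral_of_indepFun (Finset.range n)
      (fun i ω => eexp (f (x i) (m i ω))) (hmi.comp (fun i z => eexp (f (x i) z)) hg)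
      fun i => (hg i).comp (hm i)]
    refine Finset.prod_congr rfl fun i _ => ?_
    rw [eexp_neglog (hh1 _), (hlaw i).lintegral_comp (hg i).aemeasurable]
  have hG : Measurable fun p : (ℕ → Plane) × (ℕ → E) => eexp (∑' i, f (p.1 i) (p.2 i)) := by
    refine measurable_eexp.comp (Measurable.tsum fun i => ?_)
    have hp : Measurable fun p : (ℕ → Plane) × (ℕ → E) => (p.1 i, p.2 i) := by fun_prop
    exact hf.comp hp
  calc ∫⁻ ω, eexp (∑' i, f (X i ω) (m i ω)) ∂μ
      = ∫⁻ p, eexp (∑' i, f (p.1 i) (p.2 i))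
          ∂(μ.map fun ω => ((fun i => X i ω), (fun i => m i ω))) :=
        (lintegral_map hG (hXm'.prodMk hmm')).symm
    _ = ∫⁻ x, ∫⁻ z, eexp (∑' i, f (x i) (z i)) ∂(μ.map fun ω i => m i ω)
          ∂(μ.map fun ω i => X i ω) := by
        rw [hXm.map_prod_eq_prod_map_map hXm'.aemeasurable hmm'.aemeasurable]
        have := Measure.isProbabilityMeasure_map (μ := μ) hmm'.aemeasurable
        rw [lintegral_prod _ hG.aemeasurable]
    _ = ∫⁻ x, eexp (∑' i, neglog (h (x i))) ∂(μ.map fun ω i => X i ω) := by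
        refine lintegral_congr fun x => ?_
        have hGx : Measurable fun z : ℕ → E => eexp (∑' i, f (x i) (z i)) :=
          hG.comp measurable_prodMk_left
        rw [← hinner, lintegral_map hGx hmm']
    _ = ∫⁻ ω, eexp (∑' i, neglog (h (X i ω))) ∂μ := by
        rw [lintegral_map _ hXm']
        refine measurable_eexp.comp (Measurable.tsum fun i => ?_)
        exact measurable_neglog.comp (hh.comp (measurable_pi_apply i))
    _ = eexp (ENNReal.ofReal lam * ∫⁻ x, (1 - eexp (neglog (h x)))) :=
        hX.lintegral_eexp_tsum (measurable_neglog.comp hh)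
    _ = _ := by
        congr 2
        refine lintegral_congr fun x => ?_
        have hfx : Measurable fun z => eexp (f x z) := measurable_eexp.comp (hfi x)
        rw [eexp_neglog (hh1 x), lintegral_sub hfx
          ((hh1 x).trans_lt ENNReal.one_lt_top).ne (ae_of_all _ fun z => eexp_le_one _)]
        simp [h]

/-! ### Radial integrals in the plane -/

lemma lintegral_fun_norm_plane {f : ℝ → ℝ≥0∞} (hf : Measurable f) :
    ∫⁻ x : Plane, f ‖x‖
      = ENNReal.ofReal (2 * Real.pi) * ∫⁻ r in Set.Ioi (0 : ℝ), ENNReal.ofReal r * f r := by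
  have hd : Module.finrank ℝ Plane = 2 := by simp
  have hfs : Measurable fun r : Set.Ioi (0 : ℝ) => f r := hf.comp measurable_subtype_coe
  calc ∫⁻ x : Plane, f ‖x‖
      = ∫⁻ x : ({(0 : Plane)}ᶜ : Set Plane), f ‖x.1‖ ∂((volume : Measure Plane).comap (↑)) := by
        rw [lintegral_subtype_comap (measurableSet_singleton _).compl fun x => f ‖x‖,
          restrict_compl_singleton]
    _ = ∫⁻ x, f x.2 ∂((volume : Measure Plane).toSphere.prod
          (.volumeIoiPow (Module.finrank ℝ Plane - 1))) := by
        have h := (volume : Measure Plane).measurePreserving_homeomorphUnitSphereProd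
        simpa using h.lintegral_comp_emb (Homeomorph.measurableEmbedding _)
          (f ∘ Subtype.val ∘ Prod.snd)
    _ = (volume : Measure Plane).toSphere Set.univ
          * ∫⁻ r : Set.Ioi (0 : ℝ), f r ∂(.volumeIoiPow (Module.finrank ℝ Plane - 1)) := by
        have := lintegral_prod_mul (μ := (volume : Measure Plane).toSphere)
          (ν := .volumeIoiPow (Module.finrank ℝ Plane - 1)) (f := fun _ => 1)
          (g := fun r : Set.Ioi (0 : ℝ) => f r) aemeasurable_const hfs.aemeasurable
        simpa using this
    _ = _ := by
        congr 1
        · rw [Measure.toSphere_apply_univ, hd, EuclideanSpace.volume_ball_fin_two,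
            ENNReal.ofReal_mul (by norm_num)]
          simp
        · rw [hd, Measure.volumeIoiPow, lintegral_withDensity_eq_lintegral_mul _ (by fun_prop) hfs]
          simp only [Pi.mul_apply, Nat.add_one_sub_one, pow_one]
          exact lintegral_subtype_comap measurableSet_Ioi fun r => ENNReal.ofReal r * f r

lemma lintegral_unifLaw_ite {t : ℝ} (ht : t ∈ Set.Icc (0 : ℝ) 1) (a b : ℝ≥0∞) :
    ∫⁻ u, (if u ≤ t then a else b) ∂unifLaw
      = ENNReal.ofReal t * a + ENNReal.ofReal (1 - t) * b := by
  have h : ∀ u : ℝ, (if u ≤ t then a else b)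
      = (Set.Iic t).indicator (fun _ => a) u + (Set.Ioi t).indicator (fun _ => b) u := by
    intro u
    by_cases hu : u ≤ t
    · simp [hu]
    · simp [hu, not_le.1 hu]
  simp_rw [h]
  rw [lintegral_add_left (measurable_const.indicator measurableSet_Iic),
    lintegral_indicator_const measurableSet_Iic, lintegral_indicator_const measurableSet_Ioi,
    unifLaw, Measure.restrict_apply measurableSet_Iic, Measure.restrict_apply measurableSet_Ioi]
  have h1 : Set.Iic t ∩ Set.Icc 0 1 = Set.Icc 0 t := by
    ext u
    simp only [Set.mem_inter_iff, Set.mem_Iic, Set.mem_Icc]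
    constructor
    · rintro ⟨h1, h2, -⟩
      exact ⟨h2, h1⟩
    · rintro ⟨h1, h2⟩
      exact ⟨h2, h1, h2.trans ht.2⟩
  have h2 : Set.Ioi t ∩ Set.Icc 0 1 = Set.Ioc t 1 := by
    ext u
    simp only [Set.mem_inter_iff, Set.mem_Ioi, Set.mem_Icc, Set.mem_Ioc]
    constructor
    · rintro ⟨h1, -, h2⟩
      exact ⟨h1, h2⟩
    · rintro ⟨h1, h2⟩
      exact ⟨h1, ht.1.trans h1.le, h2⟩
  rw [h1, h2, Real.volume_Icc, Real.volume_Ioc, sub_zero, mul_comm a, mul_comm b]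

namespace Params

variable (S : Params)

lemma exp_neg_mem_Icc {r : ℝ} (hr : 0 ≤ r) : Real.exp (-S.β * r) ∈ Set.Icc (0 : ℝ) 1 := by
  refine ⟨(Real.exp_pos _).le, Real.exp_le_one_iff.2 ?_⟩
  nlinarith [S.β_pos]

/-- The integral over the plane of a radial quantity that depends on whether the link is LOS. -/
lemma lintegral_plane_los {A B : ℝ → ℝ≥0∞} (hA : Measurable A) (hB : Measurable B) :
    ∫⁻ x : Plane, ∫⁻ u, (if u ≤ Real.exp (-S.β * ‖x‖) then A ‖x‖ else B ‖x‖) ∂unifLaw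
      = ENNReal.ofReal (2 * Real.pi) *
        ((∫⁻ r in Set.Ioi (0 : ℝ), ENNReal.ofReal (r * Real.exp (-S.β * r)) * A r)
          + ∫⁻ r in Set.Ioi (0 : ℝ), ENNReal.ofReal (r * (1 - Real.exp (-S.β * r))) * B r) := by
  have h1 : ∀ x : Plane, ∫⁻ u, (if u ≤ Real.exp (-S.β * ‖x‖) then A ‖x‖ else B ‖x‖) ∂unifLaw
      = ENNReal.ofReal (Real.exp (-S.β * ‖x‖)) * A ‖x‖
        + ENNReal.ofReal (1 - Real.exp (-S.β * ‖x‖)) * B ‖x‖ := fun x =>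
    lintegral_unifLaw_ite (S.exp_neg_mem_Icc (norm_nonneg x)) _ _
  simp_rw [h1]
  rw [lintegral_fun_norm_plane (f := fun r => ENNReal.ofReal (Real.exp (-S.β * r)) * A r
        + ENNReal.ofReal (1 - Real.exp (-S.β * r)) * B r) (by fun_prop),
    ← lintegral_add_left (by fun_prop)]
  congr 1
  refine setLIntegral_congr_fun measurableSet_Ioi fun r hr => ?_
  have hr : (0 : ℝ) < r := hr
  rw [mul_add, ENNReal.ofReal_mul hr.le, ENNReal.ofReal_mul hr.le, mul_assoc, mul_assoc]

end Params

/-! ### The law of the transmit power -/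

/-- The fundamental theorem of calculus for a nonnegative derivative. -/
lemma lintegral_ofReal_deriv {g g' : ℝ → ℝ} {a b : ℝ} (hab : a ≤ b)
    (hcont : ContinuousOn g (Set.Icc a b)) (hderiv : ∀ x ∈ Set.Ioo a b, HasDerivAt g (g' x) x)
    (hpos : ∀ x ∈ Set.Ioo a b, 0 ≤ g' x) :
    ∫⁻ x in Set.Ioc a b, ENNReal.ofReal (g' x) = ENNReal.ofReal (g b - g a) := by
  have hint : IntegrableOn g' (Set.Ioc a b) :=
    intervalIntegral.integrableOn_deriv_of_nonneg hcont hderiv hpos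
  have hnn : 0 ≤ᵐ[volume.restrict (Set.Ioc a b)] g' := by
    rw [← Measure.restrict_congr_set Ioo_ae_eq_Ioc]
    exact (ae_restrict_iff' measurableSet_Ioo).2 (ae_of_all _ hpos)
  rw [← ofReal_integral_eq_lintegral_ofReal hint hnn, ← intervalIntegral.integral_of_le hab,
    intervalIntegral.integral_eq_sub_of_hasDerivAt_of_le hab hcont hderiv
      ((intervalIntegrable_iff_integrableOn_Ioc_of_le hab).2 hint)]

lemma setLIntegral_rpow_lt {α c : ℝ} (hα : 0 < α) (hc : 0 ≤ c) (g : ℝ → ℝ≥0∞) :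
    ∫⁻ r in Set.Ioi (0 : ℝ), g r * (if r ^ α < c then 1 else 0)
      = ∫⁻ r in Set.Ioc 0 (c ^ (1 / α)), g r := by
  rw [← setLIntegral_congr (Ioo_ae_eq_Ioc (μ := volume) (a := 0) (b := c ^ (1 / α))),
    ← lintegral_indicator measurableSet_Ioi, ← lintegral_indicator measurableSet_Ioo]
  refine lintegral_congr fun r => ?_
  by_cases hr : 0 < r
  · have hiff : r ^ α < c ↔ r < c ^ (1 / α) := by
      rw [one_div, Real.lt_rpow_inv_iff_of_pos hr.le hc hα]
    by_cases h : r ^ α < c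
    · rw [Set.indicator_of_mem (Set.mem_Ioi.2 hr),
        Set.indicator_of_mem (Set.mem_Ioo.2 ⟨hr, hiff.1 h⟩), if_pos h, mul_one]
    · rw [Set.indicator_of_mem (Set.mem_Ioi.2 hr),
        Set.indicator_of_notMem (fun h' => h (hiff.2 h'.2)), if_neg h, mul_zero]
  · rw [Set.indicator_of_notMem (Set.notMem_Ioi.2 (not_lt.1 hr)),
      Set.indicator_of_notMem (fun h => hr h.1)]

namespace Params

variable (S : Params)

/-- The primitive `κ(β r) / β²` of `r e^{-β r}`. -/
noncomputable def losPrimitive (r : ℝ) : ℝ :=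
  (1 - Real.exp (-S.β * r) * (1 + S.β * r)) / S.β ^ 2

lemma hasDerivAt_losPrimitive (r : ℝ) :
    HasDerivAt S.losPrimitive (r * Real.exp (-S.β * r)) r := by
  have hb := S.β_pos.ne'
  have h1 : HasDerivAt (fun r => Real.exp (-S.β * r)) (Real.exp (-S.β * r) * (-S.β)) r := by
    simpa using ((hasDerivAt_id r).const_mul (-S.β)).exp
  have h2 : HasDerivAt (fun r => 1 + S.β * r) S.β r := by
    simpa using ((hasDerivAt_id r).const_mul S.β).const_add 1
  have := ((h1.mul h2).const_sub 1).div_const (S.β ^ 2)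
  convert! this using 1
  field_simp
  ring

@[simp] lemma losPrimitive_zero : S.losPrimitive 0 = 0 := by simp [losPrimitive]

lemma continuous_losPrimitive : Continuous S.losPrimitive := by
  unfold losPrimitive
  fun_prop

lemma cumIntensity_eq (p : ℝ) (hp : 0 ≤ p) : S.cumIntensity p
    = S.lam * (2 * Real.pi * (S.losPrimitive ((p / S.ρ₀) ^ (1 / S.αL))
      + (((p / S.ρ₀) ^ (1 / S.αN)) ^ 2 / 2 - S.losPrimitive ((p / S.ρ₀) ^ (1 / S.αN))))) := by
  have h : (p / S.ρ₀) ^ (2 / S.αN) = ((p / S.ρ₀) ^ (1 / S.αN)) ^ 2 := by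
    rw [← Real.rpow_natCast, ← Real.rpow_mul (div_nonneg hp S.ρ₀_pos.le)]
    congr 1
    push_cast
    ring
  rw [cumIntensity, h, losPrimitive, losPrimitive]
  ring

lemma lintegral_los_disc {R : ℝ} (hR : 0 ≤ R) :
    ∫⁻ r in Set.Ioc 0 R, ENNReal.ofReal (r * Real.exp (-S.β * r))
      = ENNReal.ofReal (S.losPrimitive R) := by
  rw [lintegral_ofReal_deriv hR S.continuous_losPrimitive.continuousOn
    (fun x _ => S.hasDerivAt_losPrimitive x)
    (fun x hx => mul_nonneg hx.1.le (Real.exp_pos _).le), losPrimitive_zero, sub_zero]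

lemma lintegral_nlos_disc {R : ℝ} (hR : 0 ≤ R) :
    ∫⁻ r in Set.Ioc 0 R, ENNReal.ofReal (r * (1 - Real.exp (-S.β * r)))
      = ENNReal.ofReal (R ^ 2 / 2 - S.losPrimitive R) := by
  have hc := S.continuous_losPrimitive
  rw [lintegral_ofReal_deriv (g := fun r => r ^ 2 / 2 - S.losPrimitive r) hR (by fun_prop)
    (fun x _ => ?_)
    (fun x hx => mul_nonneg hx.1.le (sub_nonneg.2 (S.exp_neg_mem_Icc hx.1.le).2))]
  · simp
  · have := (((hasDerivAt_id x).pow 2).div_const 2).sub (S.hasDerivAt_losPrimitive x)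
    convert! this using 1
    simp
    ring

lemma losPrimitive_nonneg {R : ℝ} (hR : 0 ≤ R) : 0 ≤ S.losPrimitive R := by
  have h : MonotoneOn S.losPrimitive (Set.Ici 0) := by
    refine monotoneOn_of_deriv_nonneg (convex_Ici 0) S.continuous_losPrimitive.continuousOn
      (fun x _ => (S.hasDerivAt_losPrimitive x).differentiableAt.differentiableWithinAt) ?_
    intro x hx
    rw [interior_Ici] at hx
    rw [(S.hasDerivAt_losPrimitive x).deriv]
    exact mul_nonneg (le_of_lt hx) (Real.exp_pos _).le
  simpa using h (Set.mem_Ici.2 le_rfl) hR hR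

lemma losPrimitive_le {R : ℝ} (hR : 0 ≤ R) : S.losPrimitive R ≤ R ^ 2 / 2 := by
  have h : MonotoneOn (fun r => r ^ 2 / 2 - S.losPrimitive r) (Set.Ici 0) := by
    have hd : ∀ x : ℝ, HasDerivAt (fun r => r ^ 2 / 2 - S.losPrimitive r)
        (x * (1 - Real.exp (-S.β * x))) x := by
      intro x
      have := (((hasDerivAt_id x).pow 2).div_const 2).sub (S.hasDerivAt_losPrimitive x)
      convert! this using 1
      simp
      ring
    refine monotoneOn_of_deriv_nonneg (convex_Ici 0)
      (fun x _ => (hd x).continuousAt.continuousWithinAt)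
      (fun x _ => (hd x).differentiableAt.differentiableWithinAt) ?_
    intro x hx
    rw [interior_Ici] at hx
    rw [(hd x).deriv]
    exact mul_nonneg (le_of_lt hx) (sub_nonneg.2 (S.exp_neg_mem_Icc (le_of_lt hx)).2)
  simpa using h (Set.mem_Ici.2 le_rfl) hR hR

section TypicalUser

lemma pathloss_nonneg {Ω₀ : Type*} (Y : ℕ → Ω₀ → Plane) (V : ℕ → Ω₀ → ℝ) (i : ℕ) (ω : Ω₀) :
    0 ≤ S.pathloss Y V i ω := by
  unfold pathloss
  split_ifs <;> positivity

lemma le_inversionPower_iff {Ω₀ : Type*} {Y : ℕ → Ω₀ → Plane} {V : ℕ → Ω₀ → ℝ} (p : ℝ) (ω : Ω₀) :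
    p ≤ S.inversionPower Y V ω ↔ ∀ i, p / S.ρ₀ ≤ S.pathloss Y V i ω := by
  have hbdd : BddBelow (Set.range fun i => S.pathloss Y V i ω) :=
    ⟨0, by rintro _ ⟨i, rfl⟩; exact S.pathloss_nonneg Y V i ω⟩
  rw [inversionPower, ← div_le_iff₀' S.ρ₀_pos, le_ciInf_iff hbdd]

variable {Ω₀ : Type*} [MeasurableSpace Ω₀] {μ₀ : Measure Ω₀}
  {Y : ℕ → Ω₀ → Plane} {V : ℕ → Ω₀ → ℝ}

lemma measurable_pathloss (hY : ∀ i, Measurable (Y i)) (hV : ∀ i, Measurable (V i)) (i : ℕ) :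
    Measurable (S.pathloss Y V i) := by
  have := hY i
  have := hV i
  exact Measurable.ite (measurableSet_le (by fun_prop) (by fun_prop)) (by fun_prop) (by fun_prop)

lemma measurable_inversionPower (hY : ∀ i, Measurable (Y i)) (hV : ∀ i, Measurable (V i)) :
    Measurable (S.inversionPower Y V) :=
  (Measurable.iInf (S.measurable_pathloss hY hV)).const_mul _

/-- The power exceeds `p` if there is no base station with pathloss less than `p / ρ₀`; the
probability of this void event is `e^{-Λ(p)}`. -/
lemma measure_le_inversionPower [IsProbabilityMeasure μ₀] (hY : S.IsBSNetwork Y V μ₀) {p : ℝ}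
    (hp : 0 ≤ p) :
    μ₀ {ω | p ≤ S.inversionPower Y V ω} = ENNReal.ofReal (Real.exp (-S.cumIntensity p)) := by
  classical
  set c := p / S.ρ₀ with hc
  have hc0 : 0 ≤ c := div_nonneg hp S.ρ₀_pos.le
  let f : Plane → ℝ → ℝ≥0∞ := fun x u =>
    if u ≤ Real.exp (-S.β * ‖x‖) then (if ‖x‖ ^ S.αL < c then ∞ else 0)
    else (if ‖x‖ ^ S.αN < c then ∞ else 0)
  have hf : Measurable (Function.uncurry f) := by
    refine Measurable.ite (measurableSet_le (by fun_prop) (by fun_prop)) ?_ ?_ <;>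
    exact Measurable.ite (measurableSet_lt (by fun_prop) (by fun_prop)) measurable_const
      measurable_const
  have hfp : ∀ i ω, f (Y i ω) (V i ω) = if S.pathloss Y V i ω < c then ∞ else 0 := by
    intro i ω
    simp only [f, pathloss]
    split_ifs <;> rfl
  have hlap := hY.poisson.lintegral_eexp_tsum_marked hY.mark_measurable hY.mark_law
    hY.mark_indep hY.indep hf
  have hset : MeasurableSet {ω | p ≤ S.inversionPower Y V ω} :=
    measurableSet_le measurable_const
      (S.measurable_inversionPower hY.poisson.measurable hY.mark_measurable)
  have hL : ∀ ω, eexp (∑' i, f (Y i ω) (V i ω))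
      = {ω | p ≤ S.inversionPower Y V ω}.indicator (fun _ => 1) ω := by
    intro ω
    by_cases h : p ≤ S.inversionPower Y V ω
    · rw [Set.indicator_of_mem (show ω ∈ {ω | p ≤ S.inversionPower Y V ω} from h)]
      rw [le_inversionPower_iff] at h
      have : ∀ i, f (Y i ω) (V i ω) = 0 := fun i => by rw [hfp, if_neg (not_lt.2 (h i))]
      simp [this]
    · rw [Set.indicator_of_notMem (show ω ∉ {ω | p ≤ S.inversionPower Y V ω} from h)]
      rw [le_inversionPower_iff] at h
      push Not at h
      obtain ⟨i, hi⟩ := h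
      have : ∑' i, f (Y i ω) (V i ω) = ∞ :=
        ENNReal.tsum_eq_top_of_eq_top ⟨i, by rw [hfp, if_pos hi]⟩
      rw [this, eexp_top]
  have hI : ∫⁻ ω, eexp (∑' i, f (Y i ω) (V i ω)) ∂μ₀ = μ₀ {ω | p ≤ S.inversionPower Y V ω} := by
    simp_rw [hL]
    rw [lintegral_indicator_const hset, one_mul]
  rw [← hI, hlap]
  have hsub : ∀ x u, 1 - eexp (f x u) = if u ≤ Real.exp (-S.β * ‖x‖)
      then (fun r : ℝ => if r ^ S.αL < c then (1 : ℝ≥0∞) else 0) ‖x‖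
      else (fun r : ℝ => if r ^ S.αN < c then (1 : ℝ≥0∞) else 0) ‖x‖ := by
    intro x u
    simp only [f]
    split_ifs <;> simp
  simp_rw [hsub]
  have hmeas : ∀ α : ℝ, Measurable fun r : ℝ => if r ^ α < c then (1 : ℝ≥0∞) else 0 := fun α =>
    Measurable.ite (measurableSet_lt (by fun_prop) (by fun_prop)) measurable_const
      measurable_const
  have hRL : 0 ≤ c ^ (1 / S.αL) := Real.rpow_nonneg hc0 _
  have hRN : 0 ≤ c ^ (1 / S.αN) := Real.rpow_nonneg hc0 _
  rw [S.lintegral_plane_los (hmeas S.αL) (hmeas S.αN), setLIntegral_rpow_lt S.αL_pos hc0,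
    setLIntegral_rpow_lt S.αN_pos hc0, S.lintegral_los_disc hRL, S.lintegral_nlos_disc hRN,
    ← ENNReal.ofReal_add (S.losPrimitive_nonneg hRL) (sub_nonneg.2 (S.losPrimitive_le hRN)),
    ← ENNReal.ofReal_mul (by positivity), ← ENNReal.ofReal_mul S.lam_pos.le, eexp_ofReal,
    S.cumIntensity_eq p hp]
  have := S.losPrimitive_nonneg hRL
  have := S.losPrimitive_le hRN
  have := S.lam_pos
  have := Real.pi_pos
  exact mul_nonneg S.lam_pos.le (mul_nonneg (by positivity) (by linarith))

end TypicalUser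

lemma hasDerivAt_radius {α p : ℝ} (hp : 0 < p) :
    HasDerivAt (fun p : ℝ => (p / S.ρ₀) ^ (1 / α))
      (1 / α * (p / S.ρ₀) ^ (1 / α - 1) / S.ρ₀) p := by
  have h := ((hasDerivAt_id p).div_const S.ρ₀).rpow_const (p := 1 / α)
    (Or.inl (div_pos hp S.ρ₀_pos).ne')
  convert! h using 1
  simp only [id]
  ring

lemma radius_mul_deriv_radius {α p : ℝ} (hp : 0 < p) :
    (p / S.ρ₀) ^ (1 / α) * (1 / α * (p / S.ρ₀) ^ (1 / α - 1) / S.ρ₀)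
      = 1 / (α * S.ρ₀ ^ (2 / α)) * p ^ (2 / α - 1) := by
  have hρ := S.ρ₀_pos
  have h1 : (p / S.ρ₀) ^ (1 / α) * (p / S.ρ₀) ^ (1 / α - 1)
      = p ^ (2 / α - 1) / (S.ρ₀ ^ (2 / α) / S.ρ₀) := by
    rw [← Real.rpow_add (div_pos hp hρ), Real.div_rpow hp.le hρ.le]
    have : 1 / α + (1 / α - 1) = 2 / α - 1 := by ring
    rw [this, Real.rpow_sub_one hρ.ne']
  calc _ = ((p / S.ρ₀) ^ (1 / α) * (p / S.ρ₀) ^ (1 / α - 1)) / (α * S.ρ₀) := by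
        rw [← div_div]
        ring
    _ = _ := by
        rw [h1]
        have := Real.rpow_pos_of_pos hρ (2 / α)
        field_simp

/-- `Λ' = λ`. -/
lemma hasDerivAt_cumIntensity {p : ℝ} (hp : 0 < p) :
    HasDerivAt S.cumIntensity (S.intensity p) p := by
  have hL := S.hasDerivAt_radius (α := S.αL) hp
  have hN := S.hasDerivAt_radius (α := S.αN) hp
  have h := (((((S.hasDerivAt_losPrimitive _).comp p hL).add
    (((hN.pow 2).div_const 2).sub ((S.hasDerivAt_losPrimitive _).comp p hN))).const_mul
      (2 * Real.pi))).const_mul S.lam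
  have h' := h.congr_of_eventuallyEq (f₁ := S.cumIntensity) (by
    filter_upwards [lt_mem_nhds hp] with x hx
    exact S.cumIntensity_eq x (le_of_lt hx))
  convert! h' using 1
  have eL := S.radius_mul_deriv_radius (α := S.αL) hp
  have eN := S.radius_mul_deriv_radius (α := S.αN) hp
  rw [intensity]
  linear_combination (-(2 * Real.pi * S.lam * Real.exp (-S.β * (p / S.ρ₀) ^ (1 / S.αL)))) * eL
    - (2 * Real.pi * S.lam * (1 - Real.exp (-S.β * (p / S.ρ₀) ^ (1 / S.αN)))) * eN

lemma continuous_cumIntensity : Continuous S.cumIntensity := by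
  unfold cumIntensity
  have hL := one_div_pos.2 S.αL_pos
  have hN := one_div_pos.2 S.αN_pos
  have hN2 := div_pos two_pos S.αN_pos
  have c1 : Continuous fun p : ℝ => (p / S.ρ₀) ^ (1 / S.αL) :=
    (continuous_id.div_const _).rpow_const fun _ => Or.inr hL.le
  have c2 : Continuous fun p : ℝ => (p / S.ρ₀) ^ (1 / S.αN) :=
    (continuous_id.div_const _).rpow_const fun _ => Or.inr hN.le
  have c3 : Continuous fun p : ℝ => (p / S.ρ₀) ^ (2 / S.αN) :=
    (continuous_id.div_const _).rpow_const fun _ => Or.inr hN2.le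
  fun_prop

lemma cumIntensity_zero : S.cumIntensity 0 = 0 := by
  rw [S.cumIntensity_eq 0 le_rfl, zero_div, Real.zero_rpow (one_div_pos.2 S.αL_pos).ne',
    Real.zero_rpow (one_div_pos.2 S.αN_pos).ne']
  simp

lemma intensity_nonneg {p : ℝ} (hp : 0 ≤ p) : 0 ≤ S.intensity p := by
  have h1 := S.lam_pos
  have h2 := S.αL_pos
  have h3 := S.αN_pos
  have h4 := S.ρ₀_pos
  have h5 := Real.pi_pos
  have h6 := sub_nonneg.2
    (S.exp_neg_mem_Icc (Real.rpow_nonneg (div_nonneg hp h4.le) (1 / S.αN))).2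
  unfold intensity
  positivity

lemma intensity_pos {p : ℝ} (hp : 0 < p) : 0 < S.intensity p := by
  have h1 := S.lam_pos
  have h2 := S.αL_pos
  have h3 := S.αN_pos
  have h4 := S.ρ₀_pos
  have h5 := Real.pi_pos
  have h6 := sub_nonneg.2
    (S.exp_neg_mem_Icc (Real.rpow_nonneg (div_nonneg hp.le h4.le) (1 / S.αN))).2
  unfold intensity
  positivity

lemma hasDerivAt_neg_exp_cumIntensity {p : ℝ} (hp : 0 < p) :
    HasDerivAt (fun p => -Real.exp (-S.cumIntensity p))
      (S.intensity p * Real.exp (-S.cumIntensity p)) p := by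
  have := (S.hasDerivAt_cumIntensity hp).neg.exp.neg
  convert! this using 1
  simp only [Pi.neg_apply]
  ring

lemma continuous_neg_exp_cumIntensity :
    Continuous fun p => -Real.exp (-S.cumIntensity p) := by
  have := S.continuous_cumIntensity
  fun_prop

lemma measurable_intensity : Measurable S.intensity := by
  unfold intensity
  fun_prop

/-- The density of the untruncated transmit power. -/
noncomputable def untruncatedDensity (p : ℝ) : ℝ :=
  S.intensity p * Real.exp (-S.cumIntensity p)

lemma measurable_untruncatedDensity : Measurable S.untruncatedDensity :=
  S.measurable_intensity.mul (S.continuous_cumIntensity.neg.rexp).measurable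

lemma untruncatedDensity_nonneg {p : ℝ} (hp : 0 ≤ p) : 0 ≤ S.untruncatedDensity p :=
  mul_nonneg (S.intensity_nonneg hp) (Real.exp_pos _).le

lemma lintegral_untruncatedDensity {a b : ℝ} (ha : 0 ≤ a) (hab : a ≤ b) :
    ∫⁻ p in Set.Ioc a b, ENNReal.ofReal (S.untruncatedDensity p)
      = ENNReal.ofReal (Real.exp (-S.cumIntensity a) - Real.exp (-S.cumIntensity b)) := by
  unfold untruncatedDensity
  rw [lintegral_ofReal_deriv hab S.continuous_neg_exp_cumIntensity.continuousOn
    (fun x hx => S.hasDerivAt_neg_exp_cumIntensity (ha.trans_lt hx.1))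
    (fun x hx => S.untruncatedDensity_nonneg (ha.trans hx.1.le))]
  congr 1
  ring

lemma integrableOn_untruncatedDensity (b : ℝ) (hb : 0 ≤ b) :
    IntegrableOn S.untruncatedDensity (Set.Ioc 0 b) := by
  refine ⟨S.measurable_untruncatedDensity.aestronglyMeasurable, ?_⟩
  rw [hasFiniteIntegral_iff_ofReal ((ae_restrict_iff' measurableSet_Ioc).2
    (ae_of_all _ fun x hx => S.untruncatedDensity_nonneg hx.1.le)),
    S.lintegral_untruncatedDensity le_rfl hb]
  exact ENNReal.ofReal_lt_top

/-- The probability that a user is active. -/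
noncomputable def activeProb : ℝ := ∫ y in (0 : ℝ)..S.Pu, S.untruncatedDensity y

lemma fP_eq (p : ℝ) : S.fP p = S.activeProb⁻¹ * S.untruncatedDensity p := by
  rw [fP, activeProb]
  simp only [untruncatedDensity]
  rw [div_eq_inv_mul]

lemma lintegral_untruncatedDensity_Icc :
    ∫⁻ p in Set.Icc 0 S.Pu, ENNReal.ofReal (S.untruncatedDensity p)
      = ENNReal.ofReal S.activeProb := by
  rw [activeProb, intervalIntegral.integral_of_le S.Pu_pos.le,
    ofReal_integral_eq_lintegral_ofReal (S.integrableOn_untruncatedDensity _ S.Pu_pos.le)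
      ((ae_restrict_iff' measurableSet_Ioc).2
        (ae_of_all _ fun x hx => S.untruncatedDensity_nonneg hx.1.le)),
    setLIntegral_congr Ioc_ae_eq_Icc]

lemma activeProb_pos : 0 < S.activeProb :=
  intervalIntegral.intervalIntegral_pos_of_pos_on
    ((intervalIntegrable_iff_integrableOn_Ioc_of_le S.Pu_pos.le).2
      (S.integrableOn_untruncatedDensity _ S.Pu_pos.le))
    (fun _ hx => mul_pos (S.intensity_pos hx.1) (Real.exp_pos _)) S.Pu_pos

lemma fP_nonneg {p : ℝ} (hp : 0 ≤ p) : 0 ≤ S.fP p := by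
  rw [fP_eq]
  exact mul_nonneg (inv_nonneg.2 S.activeProb_pos.le) (S.untruncatedDensity_nonneg hp)

lemma measurable_fP : Measurable S.fP := by
  have : S.fP = fun p => S.activeProb⁻¹ * S.untruncatedDensity p := funext S.fP_eq
  rw [this]
  exact S.measurable_untruncatedDensity.const_mul _

lemma lintegral_fP : ∫⁻ p in Set.Icc 0 S.Pu, ENNReal.ofReal (S.fP p) = 1 := by
  simp_rw [fP_eq, ENNReal.ofReal_mul (inv_nonneg.2 S.activeProb_pos.le)]
  rw [lintegral_const_mul _ S.measurable_untruncatedDensity.ennreal_ofReal,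
    S.lintegral_untruncatedDensity_Icc, ENNReal.ofReal_inv_of_pos S.activeProb_pos,
    ENNReal.inv_mul_cancel (ENNReal.ofReal_pos.2 S.activeProb_pos).ne' ENNReal.ofReal_ne_top]

section TypicalUser

variable {Ω₀ : Type*} [MeasurableSpace Ω₀] {μ₀ : Measure Ω₀} [IsProbabilityMeasure μ₀]
  {Y : ℕ → Ω₀ → Plane} {V : ℕ → Ω₀ → ℝ}

lemma map_inversionPower_Ici (hY : S.IsBSNetwork Y V μ₀) (a : ℝ) :
    μ₀.map (S.inversionPower Y V) (Set.Ici a)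
      = ENNReal.ofReal (Real.exp (-S.cumIntensity (max a 0))) := by
  have hm := S.measurable_inversionPower hY.poisson.measurable hY.mark_measurable
  have := Measure.isProbabilityMeasure_map (μ := μ₀) hm.aemeasurable
  have key : ∀ {a : ℝ}, 0 ≤ a → μ₀.map (S.inversionPower Y V) (Set.Ici a)
      = ENNReal.ofReal (Real.exp (-S.cumIntensity a)) := fun {a} ha => by
    rw [Measure.map_apply hm measurableSet_Ici]
    exact S.measure_le_inversionPower hY ha
  rcases le_total 0 a with ha | ha
  · rw [max_eq_left ha, key ha]
  · rw [max_eq_right ha]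
    refine le_antisymm ?_ ?_
    · rw [cumIntensity_zero, neg_zero, Real.exp_zero, ENNReal.ofReal_one]
      exact prob_le_one
    · rw [← key le_rfl]
      exact measure_mono (Set.Ici_subset_Ici.2 ha)

/-- The law of the untruncated transmit power. -/
lemma map_inversionPower (hY : S.IsBSNetwork Y V μ₀) :
    μ₀.map (S.inversionPower Y V) = (volume.restrict (Set.Ici 0)).withDensity
      (fun p => ENNReal.ofReal (S.untruncatedDensity p)) := by
  have hm := S.measurable_inversionPower hY.poisson.measurable hY.mark_measurable
  have := Measure.isProbabilityMeasure_map (μ := μ₀) hm.aemeasurable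
  -- both measures vanish on the negative half-line, whence the positive parts of `a` and `b`
  refine Measure.ext_of_Ico _ _ fun a b hab => ?_
  have hle : max a 0 ≤ max b 0 := max_le_max_right 0 hab.le
  have hset : Set.Ico a b = Set.Ici a \ Set.Ici b := by
    ext x
    simp
  have hset' : (Set.Ico a b ∩ Set.Ici 0 : Set ℝ) =ᵐ[volume] Set.Ioc (max a 0) (max b 0) := by
    have : Set.Ico a b ∩ Set.Ici 0 = Set.Ico (max a 0) (max b 0) := by
      ext x
      simp only [Set.mem_inter_iff, Set.mem_Ico, Set.mem_Ici, max_le_iff, lt_max_iff]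
      constructor
      · rintro ⟨⟨h1, h2⟩, h3⟩
        exact ⟨⟨h1, h3⟩, Or.inl h2⟩
      · rintro ⟨⟨h1, h3⟩, h2 | h2⟩
        · exact ⟨⟨h1, h2⟩, h3⟩
        · exact absurd h2 (not_lt.2 h3)
    rw [this]
    exact Ico_ae_eq_Ioc
  rw [hset, measure_sdiff (Set.Ici_subset_Ici.2 hab.le) measurableSet_Ici.nullMeasurableSet
    (measure_ne_top _ _), S.map_inversionPower_Ici hY, S.map_inversionPower_Ici hY, ← hset,
    withDensity_apply _ measurableSet_Ico, Measure.restrict_restrict measurableSet_Ico,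
    setLIntegral_congr hset', S.lintegral_untruncatedDensity (le_max_right _ _) hle,
    ENNReal.ofReal_sub _ (Real.exp_pos _).le]

/-- `f_P` is the density of the transmit power of an active user. -/
lemma powerLaw_eq_withDensity (hY : S.IsBSNetwork Y V μ₀) :
    S.powerLaw Y V μ₀ = (volume.restrict (Set.Icc 0 S.Pu)).withDensity
      (fun p => ENNReal.ofReal (S.fP p)) := by
  have hm := S.measurable_inversionPower hY.poisson.measurable hY.mark_measurable
  have hrestr : ∀ s, MeasurableSet s →
      μ₀ ({ω | S.inversionPower Y V ω ≤ S.Pu} ∩ S.inversionPower Y V ⁻¹' s)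
        = ∫⁻ p in s ∩ Set.Icc 0 S.Pu, ENNReal.ofReal (S.untruncatedDensity p) := by
    intro s hs
    have h1 : {ω | S.inversionPower Y V ω ≤ S.Pu} ∩ S.inversionPower Y V ⁻¹' s
        = S.inversionPower Y V ⁻¹' (s ∩ Set.Iic S.Pu) := by
      ext ω
      simp [and_comm]
    rw [h1, ← Measure.map_apply hm (hs.inter measurableSet_Iic), S.map_inversionPower hY,
      withDensity_apply _ (hs.inter measurableSet_Iic),
      Measure.restrict_restrict (hs.inter measurableSet_Iic)]
    congr 2
    ext x
    simp only [Set.mem_inter_iff, Set.mem_Iic, Set.mem_Ici, Set.mem_Icc]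
    tauto
  have hZ : μ₀ {ω | S.inversionPower Y V ω ≤ S.Pu} = ENNReal.ofReal S.activeProb := by
    have := hrestr Set.univ MeasurableSet.univ
    simpa [S.lintegral_untruncatedDensity_Icc] using this
  have hset : MeasurableSet {ω | S.inversionPower Y V ω ≤ S.Pu} :=
    measurableSet_le hm measurable_const
  ext s hs
  rw [powerLaw, Measure.map_apply hm hs, cond_apply hset, hrestr s hs, hZ,
    withDensity_apply _ hs, Measure.restrict_restrict hs]
  simp_rw [fP_eq, ENNReal.ofReal_mul (inv_nonneg.2 S.activeProb_pos.le)]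
  rw [lintegral_const_mul _ S.measurable_untruncatedDensity.ennreal_ofReal,
    ENNReal.ofReal_inv_of_pos S.activeProb_pos]

lemma isProbabilityMeasure_powerLaw (hY : S.IsBSNetwork Y V μ₀) :
    IsProbabilityMeasure (S.powerLaw Y V μ₀) := by
  constructor
  rw [S.powerLaw_eq_withDensity hY, withDensity_apply _ MeasurableSet.univ, Measure.restrict_univ,
    S.lintegral_fP]

end TypicalUser

end Params

/-! ### Nakagami fading -/

/-- The Laplace transform of a gamma distribution. Multiplication by `e^{-t x}` turns its density
into a multiple of another gamma density. -/
lemma lintegral_eexp_gammaMeasure {a r t : ℝ} (ha : 0 < a) (hr : 0 < r) (ht : 0 ≤ t) :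
    ∫⁻ x, eexp (ENNReal.ofReal (t * x)) ∂(gammaMeasure a r)
      = ENNReal.ofReal ((r / (r + t)) ^ a) := by
  have hrt : 0 < r + t := by linarith
  have hm : Measurable fun x : ℝ => eexp (ENNReal.ofReal (t * x)) :=
    measurable_eexp.comp (by fun_prop)
  have hpdf : ∀ b : ℝ, Measurable (gammaPDF a b) := fun b =>
    (measurable_gammaPDFReal a b).ennreal_ofReal
  rw [gammaMeasure, lintegral_withDensity_eq_lintegral_mul _ (hpdf r) hm]
  have hpt : ∀ x, (gammaPDF a r * fun x => eexp (ENNReal.ofReal (t * x))) x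
      = ENNReal.ofReal ((r / (r + t)) ^ a) * gammaPDF a (r + t) x := by
    intro x
    rw [Pi.mul_apply]
    rcases lt_or_ge x 0 with hx | hx
    · rw [gammaPDF_of_neg hx, gammaPDF_of_neg hx, zero_mul, mul_zero]
    · rw [gammaPDF_of_nonneg hx, gammaPDF_of_nonneg hx, eexp_ofReal (mul_nonneg ht hx),
        ← ENNReal.ofReal_mul (by positivity), ← ENNReal.ofReal_mul (by positivity)]
      congr 1
      rw [Real.div_rpow hr.le hrt.le]
      have h1 : Real.exp (-((r + t) * x)) = Real.exp (-(r * x)) * Real.exp (-(t * x)) := by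
        rw [← Real.exp_add]
        congr 1
        ring
      have h2 := (Real.rpow_pos_of_pos hrt a).ne'
      rw [h1]
      field_simp
  simp_rw [hpt]
  rw [lintegral_const_mul _ (hpdf _), lintegral_gammaPDF_eq_one ha hrt, mul_one]

namespace Params

variable (S : Params)

lemma N_cast_pos : (0 : ℝ) < S.N := by exact_mod_cast S.N_pos

instance : IsProbabilityMeasure S.fadingLaw :=
  isProbabilityMeasure_gammaMeasure S.N_cast_pos S.N_cast_pos

lemma calF_nonneg (N : ℕ) {y : ℝ} (hy : 0 ≤ y) : 0 ≤ calF N y := by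
  unfold calF
  rw [sub_nonneg, div_le_one (by positivity)]
  exact one_le_pow₀ (by linarith)

/-- Bernoulli's inequality for `ℱ`. -/
lemma calF_le (N : ℕ) {y : ℝ} (hy : 0 ≤ y) : calF N y ≤ N * y := by
  unfold calF
  have h1 : (0 : ℝ) < 1 + y := by linarith
  have h2 : (-2 : ℝ) ≤ -(y / (1 + y)) := by
    have : y / (1 + y) ≤ 1 := (div_le_one h1).2 (by linarith)
    linarith
  have h3 := one_add_mul_le_pow h2 N
  have h4 : 1 + -(y / (1 + y)) = 1 / (1 + y) := by
    field_simp
    ring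
  rw [h4, one_div, inv_pow, ← one_div] at h3
  have h5 : y / (1 + y) ≤ y := div_le_self hy (by linarith)
  have h6 : (N : ℝ) * (y / (1 + y)) ≤ N * y := mul_le_mul_of_nonneg_left h5 (Nat.cast_nonneg N)
  linarith

lemma lintegral_one_sub_eexp_fadingLaw {t : ℝ} (ht : 0 ≤ t) :
    ∫⁻ x, (1 - eexp (ENNReal.ofReal (t * x))) ∂S.fadingLaw
      = ENNReal.ofReal (calF S.N (t / S.N)) := by
  have hN := S.N_cast_pos
  have hm : Measurable fun x : ℝ => eexp (ENNReal.ofReal (t * x)) :=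
    measurable_eexp.comp (by fun_prop)
  have hfin : ∫⁻ x, eexp (ENNReal.ofReal (t * x)) ∂S.fadingLaw ≠ ∞ :=
    ((lintegral_mono fun x => eexp_le_one _).trans_lt (by simp)).ne
  rw [lintegral_sub hm hfin (ae_of_all _ fun x => eexp_le_one _), lintegral_one, measure_univ,
    fadingLaw, lintegral_eexp_gammaMeasure hN hN ht, ← ENNReal.ofReal_one,
    ← ENNReal.ofReal_sub _ (by positivity), calF, Real.rpow_natCast]
  congr 2
  rw [← one_div_pow]
  congr 1
  field_simp

lemma fadingLaw_Iic_zero : S.fadingLaw (Set.Iic 0) = 0 := by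
  rw [fadingLaw, gammaMeasure, withDensity_apply _ measurableSet_Iic,
    ← setLIntegral_congr (Iio_ae_eq_Iic (μ := volume)), lintegral_gammaPDF_of_nonpos le_rfl]

lemma fadingLaw_singleton (x : ℝ) : S.fadingLaw {x} = 0 :=
  withDensity_absolutelyContinuous _ _ (measure_singleton x)

lemma fadingLaw_ofReal_le (t : ℝ≥0∞) :
    S.fadingLaw.real {x | ENNReal.ofReal x ≤ t} = S.fadingCDF t := by
  rw [fadingCDF]
  refine measureReal_congr ?_
  have hnull : ∀ᵐ x ∂S.fadingLaw, x ∉ Set.Iic 0 ∪ {t.toReal} :=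
    measure_eq_zero_iff_ae_notMem.1
      (measure_union_null S.fadingLaw_Iic_zero (S.fadingLaw_singleton _))
  filter_upwards [hnull] with x hx
  simp only [Set.mem_union, Set.mem_Iic, Set.mem_singleton_iff, not_or, not_le] at hx
  refine propext ⟨fun h => lt_of_le_of_ne h fun he => hx.2 ?_, fun h => le_of_lt h⟩
  rw [← he, ENNReal.toReal_ofReal hx.1.le]

/-! ### The exact outage probability -/

lemma gain_pos : 0 < S.gain := mul_pos S.GbMax_pos S.GuMax_pos

/-- The contribution, to the interference, of an interferer at distance `r` over a link with
pathloss exponent `α`, where `w` consists of the transmit power, the gain and the fading power. -/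
noncomputable def received (α r : ℝ) (w : ℝ × ℝ × ℝ) : ℝ≥0∞ :=
  if w.1 * r ^ (-α) < S.ρ₀ then ENNReal.ofReal (w.1 * w.2.1 * w.2.2 * r ^ (-α)) else 0

/-- The contribution of an interferer at the point `x` with the marks `z`. -/
noncomputable def interfererTerm (x : Plane) (z : ℝ × ℝ × ℝ × ℝ) : ℝ≥0∞ :=
  if z.1 ≤ Real.exp (-S.β * ‖x‖) then S.received S.αL ‖x‖ z.2 else S.received S.αN ‖x‖ z.2

lemma measurable_received (α : ℝ) :
    Measurable fun p : ℝ × (ℝ × ℝ × ℝ) => S.received α p.1 p.2 :=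
  Measurable.ite (measurableSet_lt (by fun_prop) (by fun_prop)) (by fun_prop) measurable_const

lemma measurable_interfererTerm : Measurable (Function.uncurry S.interfererTerm) := by
  have h : ∀ α, Measurable fun p : Plane × (ℝ × ℝ × ℝ × ℝ) => S.received α ‖p.1‖ p.2.2 := by
    intro α
    have hp : Measurable fun p : Plane × (ℝ × ℝ × ℝ × ℝ) => (‖p.1‖, p.2.2) := by fun_prop
    exact (S.measurable_received α).comp hp
  exact Measurable.ite (measurableSet_le (by fun_prop) (by fun_prop)) (h _) (h _)

lemma disturbance_eq {Ω : Type*} (X : ℕ → Ω → Plane) (M : Marks Ω) (ω : Ω) :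
    S.disturbance X M ω
      = ENNReal.ofReal S.σsq + ∑' i, S.interfererTerm (X i ω) (M.tuple i ω) := by
  rw [disturbance, interferenceLOS, interferenceNLOS, add_assoc, ← ENNReal.tsum_add]
  congr 1
  refine tsum_congr fun i => ?_
  rw [interfererTerm, received, received]
  simp only [Marks.tuple, IsLOS]
  by_cases h : M.U i ω ≤ Real.exp (-S.β * ‖X i ω‖)
  · simp only [h, true_and, not_true_eq_false, false_and, if_true, if_false, add_zero]
    congr
  · simp only [h, false_and, not_false_eq_true, true_and, if_false, zero_add]
    congr

/-- The level as a function of the points and the marks. -/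
noncomputable def levelOf (p : (ℕ → Plane) × (ℕ → ℝ × ℝ × ℝ × ℝ)) : ℝ≥0∞ :=
  ENNReal.ofReal (S.θ / (S.ρ₀ * S.gain))
    * (ENNReal.ofReal S.σsq + ∑' i, S.interfererTerm (p.1 i) (p.2 i))

lemma measurable_levelOf : Measurable S.levelOf := by
  refine Measurable.const_mul (Measurable.const_add (Measurable.tsum fun i => ?_) _) _
  have hp : Measurable fun p : (ℕ → Plane) × (ℕ → ℝ × ℝ × ℝ × ℝ) => (p.1 i, p.2 i) := by fun_prop
  exact S.measurable_interfererTerm.comp hp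

lemma level_eq {Ω : Type*} (X : ℕ → Ω → Plane) (M : Marks Ω) (ω : Ω) :
    S.level X M ω = S.levelOf (fun i => X i ω, fun i => M.tuple i ω) := by
  rw [level, disturbance_eq, levelOf]

section Uplink

variable {Ω : Type*} {X : ℕ → Ω → Plane} {M : Marks Ω} {h₀ : Ω → ℝ}

lemma ofReal_mul_level_eq (ω : Ω) :
    ENNReal.ofReal (S.ρ₀ * S.gain) * S.level X M ω = ENNReal.ofReal S.θ * S.disturbance X M ω := by
  have h := mul_pos S.ρ₀_pos S.gain_pos
  rw [level, ← mul_assoc, ← ENNReal.ofReal_mul h.le, mul_div_cancel₀ _ h.ne']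

lemma ofReal_signal_eq (ω : Ω) : ENNReal.ofReal (S.ρ₀ * h₀ ω * S.gain)
    = ENNReal.ofReal (S.ρ₀ * S.gain) * ENNReal.ofReal (h₀ ω) := by
  rw [← ENNReal.ofReal_mul (mul_pos S.ρ₀_pos S.gain_pos).le]
  congr 1
  ring

/-- For `h₀ ω = 0` and a vanishing disturbance, `SINR` is `0 / 0 = 0` and the level is `0`, so that
the equivalence fails there. -/
lemma SINR_lt_iff {ω : Ω} (hω : 0 < h₀ ω) :
    S.SINR h₀ X M ω < ENNReal.ofReal S.θ ↔ ENNReal.ofReal (h₀ ω) < S.level X M ω := by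
  have hs := (ENNReal.ofReal_pos.2 (mul_pos (mul_pos S.ρ₀_pos hω) S.gain_pos)).ne'
  have hg := (ENNReal.ofReal_pos.2 (mul_pos S.ρ₀_pos S.gain_pos)).ne'
  rw [SINR, ENNReal.div_lt_iff (Or.inr hs) (Or.inr ENNReal.ofReal_ne_top),
    ← ofReal_mul_level_eq, ofReal_signal_eq, ENNReal.mul_lt_mul_iff_right hg ENNReal.ofReal_ne_top]

lemma SINR_le_iff (ω : Ω) :
    S.SINR h₀ X M ω ≤ ENNReal.ofReal S.θ ↔ ENNReal.ofReal (h₀ ω) ≤ S.level X M ω := by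
  have hθ := (ENNReal.ofReal_pos.2 S.θ_pos).ne'
  have hg := (ENNReal.ofReal_pos.2 (mul_pos S.ρ₀_pos S.gain_pos)).ne'
  rw [SINR, ENNReal.div_le_iff_le_mul (Or.inr ENNReal.ofReal_ne_top) (Or.inr hθ),
    ← ofReal_mul_level_eq, ofReal_signal_eq, ENNReal.mul_le_mul_iff_right hg ENNReal.ofReal_ne_top]

end Uplink

end Params

/-- The probability that an independent pair lies in a set, by conditioning on the second entry. -/
lemma measureReal_indepFun_mem {Ω α β : Type*} [MeasurableSpace Ω] [MeasurableSpace α]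
    [MeasurableSpace β] {μ : Measure Ω} [IsProbabilityMeasure μ] {U : Ω → α} {T : Ω → β}
    {ν : Measure α} (hU : Measurable U) (hlaw : HasLaw U ν μ) (hT : Measurable T)
    (hind : IndepFun U T μ) {s : Set (α × β)} (hs : MeasurableSet s) :
    μ.real {ω | (U ω, T ω) ∈ s} = ∫ ω, ν.real {x | (x, T ω) ∈ s} ∂μ := by
  have hν : IsProbabilityMeasure ν := hlaw.isProbabilityMeasure_iff.1 inferInstance
  have := Measure.isProbabilityMeasure_map (μ := μ) hT.aemeasurable
  have hsm : Measurable fun t => ν ((fun x => (x, t)) ⁻¹' s) := measurable_measure_prodMk_right hs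
  have h : μ {ω | (U ω, T ω) ∈ s} = ∫⁻ ω, ν {x | (x, T ω) ∈ s} ∂μ := by
    have h1 : μ {ω | (U ω, T ω) ∈ s} = (μ.map fun ω => (U ω, T ω)) s :=
      (Measure.map_apply (hU.prodMk hT) hs).symm
    rw [h1, hind.map_prod_eq_prod_map_map hU.aemeasurable hT.aemeasurable, hlaw.map_eq,
      Measure.prod_apply_symm hs, lintegral_map hsm hT]
    rfl
  rw [measureReal_def, h]
  exact (integral_toReal (hsm.comp hT).aemeasurable (ae_of_all _ fun ω => measure_lt_top _ _)).symm

namespace Params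

variable (S : Params) {Ω : Type*} [MeasurableSpace Ω] {μ : Measure Ω}
  {π : Measure ℝ} {X : ℕ → Ω → Plane} {M : Marks Ω} {h₀ : Ω → ℝ}

lemma measurable_points_marks (hX : S.IsUplink π h₀ X M μ) :
    Measurable fun ω => ((fun i => X i ω), (fun i => M.tuple i ω)) :=
  (measurable_pi_lambda _ hX.poisson.measurable).prodMk (measurable_pi_lambda _ hX.mark_measurable)

lemma measurable_level (hX : S.IsUplink π h₀ X M μ) : Measurable (S.level X M) := by
  have : S.level X M = fun ω => S.levelOf (fun i => X i ω, fun i => M.tuple i ω) :=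
    funext (S.level_eq X M)
  rw [this]
  exact S.measurable_levelOf.comp (S.measurable_points_marks hX)

lemma indepFun_desired_level (hX : S.IsUplink π h₀ X M μ) : IndepFun h₀ (S.level X M) μ := by
  have : S.level X M = S.levelOf ∘ fun ω => ((fun i => X i ω), (fun i => M.tuple i ω)) :=
    funext (S.level_eq X M)
  rw [this]
  exact hX.desired_indep.comp measurable_id S.measurable_levelOf

variable [IsProbabilityMeasure μ]

lemma measureReal_SINR_lt (hX : S.IsUplink π h₀ X M μ) :
    μ.real {ω | S.SINR h₀ X M ω < ENNReal.ofReal S.θ} = S.outage S.fadingCDF X M μ := by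
  have hpos : ∀ᵐ ω ∂μ, 0 < h₀ ω := by
    have h : ∀ᵐ x ∂S.fadingLaw, x ∉ Set.Iic 0 :=
      measure_eq_zero_iff_ae_notMem.1 S.fadingLaw_Iic_zero
    rw [← hX.desired_law.map_eq] at h
    filter_upwards [ae_of_ae_map hX.desired_measurable.aemeasurable h] with ω hω
    exact not_le.1 hω
  have hset : {ω | S.SINR h₀ X M ω < ENNReal.ofReal S.θ}
      =ᵐ[μ] {ω | ENNReal.ofReal (h₀ ω) < S.level X M ω} := by
    filter_upwards [hpos] with ω hω
    exact propext (S.SINR_lt_iff hω)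
  rw [measureReal_congr hset]
  exact measureReal_indepFun_mem (s := {p : ℝ × ℝ≥0∞ | ENNReal.ofReal p.1 < p.2})
    hX.desired_measurable hX.desired_law (S.measurable_level hX) (S.indepFun_desired_level hX)
    (measurableSet_lt (by fun_prop) (by fun_prop))

lemma measureReal_SINR_le (hX : S.IsUplink π h₀ X M μ) :
    μ.real {ω | S.SINR h₀ X M ω ≤ ENNReal.ofReal S.θ} = S.outage S.fadingCDF X M μ := by
  simp_rw [SINR_le_iff]
  refine (measureReal_indepFun_mem (s := {p : ℝ × ℝ≥0∞ | ENNReal.ofReal p.1 ≤ p.2})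
    hX.desired_measurable hX.desired_law (S.measurable_level hX) (S.indepFun_desired_level hX)
    (measurableSet_le (by fun_prop) (by fun_prop))).trans ?_
  exact integral_congr_ae (ae_of_all _ fun ω => S.fadingLaw_ofReal_le _)

end Params

/-! ### The interference integrals -/

lemma lintegral_Ioi_comp_mul_left {c : ℝ} (hc : 0 < c) (g : ℝ → ℝ≥0∞) :
    ∫⁻ r in Set.Ioi (0 : ℝ), g r = ∫⁻ y in Set.Ioi (0 : ℝ), ENNReal.ofReal c * g (c * y) := by
  have himg : (fun y => c * y) '' Set.Ioi (0 : ℝ) = Set.Ioi 0 := by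
    ext r
    simp only [Set.mem_image, Set.mem_Ioi]
    constructor
    · rintro ⟨y, hy, rfl⟩
      positivity
    · intro hr
      exact ⟨r / c, by positivity, by field_simp⟩
  have h := lintegral_image_eq_lintegral_abs_deriv_mul (f := fun y => c * y) (f' := fun _ => c)
    (measurableSet_Ioi (a := (0 : ℝ)))
    (fun x _ => by simpa using ((hasDerivAt_id x).const_mul c).hasDerivWithinAt)
    (fun x _ y _ hxy => mul_left_cancel₀ hc.ne' hxy) g
  rw [himg, abs_of_pos hc] at h
  exact h

namespace Params

variable (S : Params)

lemma measurable_calF (N : ℕ) : Measurable (calF N) := by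
  unfold calF
  fun_prop

lemma div_two_pi_mem {ζ : ℝ} (h : ζ ∈ Set.Icc 0 (2 * Real.pi)) :
    ζ / (2 * Real.pi) ∈ Set.Icc (0 : ℝ) 1 :=
  ⟨div_nonneg h.1 (by positivity), (div_le_one (by positivity)).2 h.2⟩

lemma b_nonneg (v : Fin 4) : 0 ≤ S.b v := by
  obtain ⟨hr0, hr1⟩ := div_two_pi_mem S.ζr_mem
  obtain ⟨ht0, ht1⟩ := div_two_pi_mem S.ζt_mem
  have hr := S.ζr_mem.1
  have ht := S.ζt_mem.1
  have hr1' := sub_nonneg.2 hr1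
  have ht1' := sub_nonneg.2 ht1
  fin_cases v
  · simp only [b]
    exact div_nonneg (mul_nonneg hr ht) (by positivity)
  · exact mul_nonneg hr0 ht1'
  · exact mul_nonneg hr1' ht0
  · exact mul_nonneg hr1' ht1'

lemma sum_b : ∑ v, S.b v = 1 := by
  have := Real.pi_pos.ne'
  simp only [Fin.sum_univ_four, b, Matrix.cons_val]
  field_simp
  ring

lemma a_pos (v : Fin 4) : 0 < S.a v := by
  fin_cases v
  · exact mul_pos S.GbMax_pos S.GuMax_pos
  · exact mul_pos S.GbMax_pos S.GuMin_pos
  · exact mul_pos S.GbMin_pos S.GuMax_pos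
  · exact mul_pos S.GbMin_pos S.GuMin_pos

instance : IsProbabilityMeasure S.gainLaw := by
  constructor
  simp only [gainLaw, Measure.finsetSum_apply, Measure.smul_apply, measure_univ, smul_eq_mul,
    mul_one]
  rw [← ENNReal.ofReal_sum_of_nonneg (fun v _ => S.b_nonneg v), sum_b, ENNReal.ofReal_one]

lemma lintegral_gainLaw (f : ℝ → ℝ≥0∞) :
    ∫⁻ g, f g ∂S.gainLaw = ∑ v, ENNReal.ofReal (S.b v) * f (S.a v) := by
  simp [gainLaw, lintegral_finsetSum_measure, lintegral_smul_measure]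

lemma eta_pos : 0 < S.eta :=
  mul_pos S.N_cast_pos (Real.rpow_pos_of_pos (by exact_mod_cast S.N.factorial_pos) _)

/-- The mean of `1 - e^{-s J}`, where `J` is the contribution of an interferer at distance `r`. -/
lemma lintegral_one_sub_eexp_received {π : Measure ℝ}
    (hπ : π = (volume.restrict (Set.Icc 0 S.Pu)).withDensity (fun p => ENNReal.ofReal (S.fP p)))
    {α s r : ℝ} (hs : 0 ≤ s) (hr : 0 ≤ r) :
    ∫⁻ w, (1 - eexp (ENNReal.ofReal s * S.received α r w))
        ∂(π.prod (S.gainLaw.prod S.fadingLaw))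
      = ∑ v, ENNReal.ofReal (S.b v) * ∫⁻ p in Set.Icc 0 S.Pu, ENNReal.ofReal (S.fP p) *
        (if p * r ^ (-α) < S.ρ₀ then ENNReal.ofReal (calF S.N (s * S.a v * p * r ^ (-α) / S.N))
          else 0) := by
  have hsub : Measurable fun y : ℝ≥0∞ => 1 - eexp y := measurable_const.sub measurable_eexp
  have hm : Measurable fun w : ℝ × ℝ × ℝ =>
      1 - eexp (ENNReal.ofReal s * S.received α r w) := by
    have := (S.measurable_received α).comp (measurable_prodMk_left (x := r))
    exact hsub.comp (this.const_mul _)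
  have hrα : 0 ≤ r ^ (-α) := Real.rpow_nonneg hr _
  have hinner : ∀ p, 0 ≤ p →
      ∫⁻ w, (1 - eexp (ENNReal.ofReal s * S.received α r (p, w))) ∂(S.gainLaw.prod S.fadingLaw)
        = ∑ v, ENNReal.ofReal (S.b v) * (if p * r ^ (-α) < S.ρ₀ then
          ENNReal.ofReal (calF S.N (s * S.a v * p * r ^ (-α) / S.N)) else 0) := by
    intro p hp
    by_cases hc : p * r ^ (-α) < S.ρ₀
    · simp only [received, if_pos hc]
      have hm' : Measurable fun w : ℝ × ℝ => 1 - eexp (ENNReal.ofReal s *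
          ENNReal.ofReal (p * w.1 * w.2 * r ^ (-α))) := by
        have : Measurable fun w : ℝ × ℝ => ENNReal.ofReal s *
          ENNReal.ofReal (p * w.1 * w.2 * r ^ (-α)) := by fun_prop
        exact hsub.comp this
      rw [lintegral_prod _ hm'.aemeasurable, lintegral_gainLaw]
      refine Finset.sum_congr rfl fun v _ => ?_
      congr 1
      rw [← S.lintegral_one_sub_eexp_fadingLaw
        (mul_nonneg (mul_nonneg (mul_nonneg hs (S.a_pos v).le) hp) hrα)]
      refine lintegral_congr fun x => ?_
      rw [← ENNReal.ofReal_mul hs]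
      congr 3
      ring
    · simp [received, if_neg hc]
  have hterm : ∀ v, Measurable fun p : ℝ => ENNReal.ofReal (S.fP p) *
      (if p * r ^ (-α) < S.ρ₀ then ENNReal.ofReal (calF S.N (s * S.a v * p * r ^ (-α) / S.N))
        else 0) := fun v => by
    refine S.measurable_fP.ennreal_ofReal.mul (Measurable.ite
      (measurableSet_lt (by fun_prop) (by fun_prop)) ?_ measurable_const)
    exact ((measurable_calF S.N).comp (by fun_prop)).ennreal_ofReal
  rw [lintegral_prod _ hm.aemeasurable, hπ, lintegral_withDensity_eq_lintegral_mul _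
    S.measurable_fP.ennreal_ofReal hm.lintegral_prod_right']
  have hcong : ∀ p ∈ Set.Icc 0 S.Pu, ((fun p => ENNReal.ofReal (S.fP p)) * fun p =>
      ∫⁻ w, (1 - eexp (ENNReal.ofReal s * S.received α r (p, w)))
        ∂(S.gainLaw.prod S.fadingLaw)) p
      = ∑ v, ENNReal.ofReal (S.b v) * (ENNReal.ofReal (S.fP p) * (if p * r ^ (-α) < S.ρ₀ then
          ENNReal.ofReal (calF S.N (s * S.a v * p * r ^ (-α) / S.N)) else 0)) := by
    intro p hp
    rw [Pi.mul_apply, hinner p hp.1, Finset.mul_sum]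
    exact Finset.sum_congr rfl fun v _ => by rw [mul_left_comm]
  rw [setLIntegral_congr_fun measurableSet_Icc hcong,
    lintegral_finsetSum _ fun v _ => (hterm v).const_mul _]
  exact Finset.sum_congr rfl fun v _ => lintegral_const_mul _ (hterm v)

/-- The substitution `r = (q p)^{1/α} y`, which removes the power `p` from the truncation and from
the argument of `ℱ`. -/
lemma lintegral_radial_substitution {α q p : ℝ} (hα : 0 < α) (hq : 0 < q) (hp : 0 < p)
    {w : ℝ → ℝ} (hw : ∀ r, 0 ≤ r → 0 ≤ w r) :
    ∫⁻ r in Set.Ioi (0 : ℝ), ENNReal.ofReal (r * w r) * (if p * r ^ (-α) < S.ρ₀ then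
        ENNReal.ofReal (calF S.N (q * p * r ^ (-α) / S.N)) else 0)
      = ∫⁻ y in Set.Ioi ((q * S.ρ₀) ^ (-1 / α)),
        ENNReal.ofReal (calF S.N (y ^ (-α) / S.N) * w ((q * p) ^ (1 / α) * y) * y
          * (q * p) ^ (2 / α)) := by
  have hqp : 0 < q * p := mul_pos hq hp
  have hqρ : 0 < q * S.ρ₀ := mul_pos hq S.ρ₀_pos
  set c := (q * p) ^ (1 / α) with hc
  have hc0 : 0 < c := Real.rpow_pos_of_pos hqp _
  have hA0 : 0 < (q * S.ρ₀) ^ (-1 / α) := Real.rpow_pos_of_pos hqρ _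
  have hcα : c ^ (-α) = (q * p)⁻¹ := by
    rw [hc, ← Real.rpow_mul hqp.le, ← Real.rpow_neg_one]
    congr 1
    field_simp
  have hc2 : (q * p) ^ (2 / α) = c * c := by
    rw [hc, ← Real.rpow_add hqp]
    congr 1
    ring
  rw [lintegral_Ioi_comp_mul_left hc0, ← lintegral_indicator measurableSet_Ioi,
    ← lintegral_indicator measurableSet_Ioi]
  refine lintegral_congr fun y => ?_
  rcases le_or_gt y 0 with hy | hy
  · rw [Set.indicator_of_notMem (Set.notMem_Ioi.2 hy),
      Set.indicator_of_notMem (Set.notMem_Ioi.2 (hy.trans hA0.le))]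
  have hcy : (c * y) ^ (-α) = (q * p)⁻¹ * y ^ (-α) := by
    rw [Real.mul_rpow hc0.le hy.le, hcα]
  have hiff : p * (c * y) ^ (-α) < S.ρ₀ ↔ (q * S.ρ₀) ^ (-1 / α) < y := by
    have h1 : (-1 / α) = (-α)⁻¹ := by
      rw [neg_div, one_div, inv_neg]
    rw [h1, Real.rpow_inv_lt_iff_of_neg hqρ hy (neg_neg_of_pos hα), hcy]
    have h2 : p * ((q * p)⁻¹ * y ^ (-α)) = y ^ (-α) / q := by
      field_simp
    rw [h2, div_lt_iff₀' hq]
  rw [Set.indicator_of_mem (Set.mem_Ioi.2 hy)]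
  by_cases h : (q * S.ρ₀) ^ (-1 / α) < y
  · rw [Set.indicator_of_mem (Set.mem_Ioi.2 h), if_pos (hiff.2 h)]
    have hyα : 0 ≤ y ^ (-α) / S.N := by positivity
    have h3 : q * p * (c * y) ^ (-α) / S.N = y ^ (-α) / S.N := by
      rw [hcy]
      field_simp
    have hwy := hw (c * y) (by positivity)
    rw [h3, ← mul_assoc, ← ENNReal.ofReal_mul hc0.le, ← ENNReal.ofReal_mul (by positivity), hc2]
    congr 1
    ring
  · rw [Set.indicator_of_notMem (Set.notMem_Ioi.2 (not_lt.1 h)),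
      if_neg (fun h' => h (hiff.1 h')), mul_zero, mul_zero]

/-- The double integrals of `Q n` and `V n`, where `w r` is the probability that a link of
length `r` is of the kind considered. -/
noncomputable def interferenceSum (α : ℝ) (w : ℝ → ℝ) (n : ℕ) : ℝ≥0∞ :=
  ∑ v, ENNReal.ofReal (S.b v * S.q n v ^ (2 / α)) *
    ∫⁻ y in Set.Ioi ((S.q n v * S.ρ₀) ^ (-1 / α)), ∫⁻ p in Set.Icc 0 S.Pu,
      ENNReal.ofReal (calF S.N (y ^ (-α) / S.N) * w ((S.q n v * p) ^ (1 / α) * y)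
        * y * p ^ (2 / α) * S.fP p)

lemma q_eq (n : ℕ) (v : Fin 4) :
    S.q n v = S.eta * n * S.θ / (S.ρ₀ * S.gain) * S.a v := by
  rw [q]
  ring

lemma q_pos {n : ℕ} (hn : 1 ≤ n) (v : Fin 4) : 0 < S.q n v := by
  have h1 : (0 : ℝ) < n := by exact_mod_cast hn
  have h2 := S.eta_pos
  have h3 := S.θ_pos
  have h4 := S.a_pos v
  have h5 := S.gain_pos
  have h6 := S.ρ₀_pos
  unfold q
  positivity

lemma q_mul_ρ₀ (n : ℕ) (v : Fin 4) :
    S.q n v * S.ρ₀ = S.eta * n * S.θ * S.a v / S.gain := by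
  have h5 := S.gain_pos.ne'
  have h6 := S.ρ₀_pos.ne'
  unfold q
  field_simp

lemma Q_eq (n : ℕ) : S.Q n = ENNReal.ofReal (2 * Real.pi * S.lam)
    * S.interferenceSum S.αL (fun r => Real.exp (-S.β * r)) n := by
  simp only [Q, interferenceSum, calA, q_mul_ρ₀, mul_assoc]

lemma V_eq (n : ℕ) : S.V n = ENNReal.ofReal (2 * Real.pi * S.lam)
    * S.interferenceSum S.αN (fun r => 1 - Real.exp (-S.β * r)) n := by
  simp only [V, interferenceSum, calB, q_mul_ρ₀, mul_assoc]

/-- The radial integral of the mean of `1 - e^{-s J}`, in the form of the double integrals. -/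
lemma lintegral_received_eq_interferenceSum {π : Measure ℝ}
    (hπ : π = (volume.restrict (Set.Icc 0 S.Pu)).withDensity (fun p => ENNReal.ofReal (S.fP p)))
    {α : ℝ} (hα : 0 < α) {w : ℝ → ℝ} (hwm : Measurable w) (hw : ∀ r, 0 ≤ r → 0 ≤ w r)
    {n : ℕ} (hn : 1 ≤ n) :
    ∫⁻ r in Set.Ioi (0 : ℝ), ENNReal.ofReal (r * w r) *
        ∫⁻ m, (1 - eexp (ENNReal.ofReal (S.eta * n * S.θ / (S.ρ₀ * S.gain)) * S.received α r m))
          ∂(π.prod (S.gainLaw.prod S.fadingLaw))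
      = S.interferenceSum α w n := by
  have hs : 0 ≤ S.eta * n * S.θ / (S.ρ₀ * S.gain) := by
    have h2 := S.eta_pos
    have h3 := S.θ_pos
    have h5 := S.gain_pos
    have h6 := S.ρ₀_pos
    positivity
  let G : Fin 4 → ℝ → ℝ → ℝ≥0∞ := fun v r p => if p * r ^ (-α) < S.ρ₀ then
    ENNReal.ofReal (calF S.N (S.q n v * p * r ^ (-α) / S.N)) else 0
  have hG : ∀ v, Measurable (Function.uncurry (G v)) := fun v =>
    Measurable.ite (measurableSet_lt (by fun_prop) (by fun_prop))
      ((measurable_calF S.N).comp (by fun_prop)).ennreal_ofReal measurable_const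
  have hfP := S.measurable_fP
  have hfG : ∀ v, Measurable (Function.uncurry fun r p => ENNReal.ofReal (S.fP p) * G v r p) :=
    fun v => (hfP.comp measurable_snd).ennreal_ofReal.mul (hG v)
  have hrw : Measurable fun r => ENNReal.ofReal (r * w r) := by fun_prop
  have h1 : ∀ r ∈ Set.Ioi (0 : ℝ), ENNReal.ofReal (r * w r) *
        ∫⁻ m, (1 - eexp (ENNReal.ofReal (S.eta * n * S.θ / (S.ρ₀ * S.gain)) * S.received α r m))
          ∂(π.prod (S.gainLaw.prod S.fadingLaw))
      = ∑ v, ENNReal.ofReal (S.b v) * (ENNReal.ofReal (r * w r) *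
          ∫⁻ p in Set.Icc 0 S.Pu, ENNReal.ofReal (S.fP p) * G v r p) := by
    intro r hr
    rw [S.lintegral_one_sub_eexp_received hπ hs (le_of_lt hr), Finset.mul_sum]
    refine Finset.sum_congr rfl fun v _ => ?_
    rw [mul_left_comm]
    simp only [G, q_eq]
  have hmeas : ∀ v, Measurable fun r => ENNReal.ofReal (r * w r) *
      ∫⁻ p in Set.Icc 0 S.Pu, ENNReal.ofReal (S.fP p) * G v r p := fun v =>
    hrw.mul (hfG v).lintegral_prod_right'
  rw [setLIntegral_congr_fun measurableSet_Ioi h1,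
    lintegral_finsetSum _ fun v _ => (hmeas v).const_mul _, interferenceSum]
  refine Finset.sum_congr rfl fun v _ => ?_
  have hq := S.q_pos hn v
  rw [lintegral_const_mul _ (hmeas v), ENNReal.ofReal_mul (S.b_nonneg v), mul_assoc]
  congr 1
  let K : ℝ → ℝ → ℝ≥0∞ := fun y p => ENNReal.ofReal (calF S.N (y ^ (-α) / S.N)
    * w ((S.q n v * p) ^ (1 / α) * y) * y * p ^ (2 / α) * S.fP p)
  have hF := measurable_calF S.N
  have hK : Measurable (Function.uncurry K) := by
    have h1 : Measurable fun x : ℝ × ℝ => calF S.N (x.1 ^ (-α) / S.N) := hF.comp (by fun_prop)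
    have h2 : Measurable fun x : ℝ × ℝ => w ((S.q n v * x.2) ^ (1 / α) * x.1) :=
      hwm.comp (by fun_prop)
    have h3 : Measurable fun x : ℝ × ℝ => x.2 ^ (2 / α) := by fun_prop
    exact ((((h1.mul h2).mul measurable_fst).mul h3).mul (hfP.comp measurable_snd)).ennreal_ofReal
  have hprod : Measurable (Function.uncurry fun r p =>
      ENNReal.ofReal (r * w r) * (ENNReal.ofReal (S.fP p) * G v r p)) :=
    (hrw.comp measurable_fst).mul (hfG v)
  calc ∫⁻ r in Set.Ioi (0 : ℝ), ENNReal.ofReal (r * w r) *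
          ∫⁻ p in Set.Icc 0 S.Pu, ENNReal.ofReal (S.fP p) * G v r p
      = ∫⁻ r in Set.Ioi (0 : ℝ), ∫⁻ p in Set.Icc 0 S.Pu,
          ENNReal.ofReal (r * w r) * (ENNReal.ofReal (S.fP p) * G v r p) :=
        lintegral_congr fun r =>
          (lintegral_const_mul _ ((hfG v).comp measurable_prodMk_left)).symm
    _ = ∫⁻ p in Set.Icc 0 S.Pu, ∫⁻ r in Set.Ioi (0 : ℝ),
          ENNReal.ofReal (r * w r) * (ENNReal.ofReal (S.fP p) * G v r p) :=
        lintegral_lintegral_swap hprod.aemeasurable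
    -- the substitution needs `p > 0`
    _ = ∫⁻ p in Set.Ioc 0 S.Pu, ∫⁻ r in Set.Ioi (0 : ℝ),
          ENNReal.ofReal (r * w r) * (ENNReal.ofReal (S.fP p) * G v r p) :=
        (setLIntegral_congr Ioc_ae_eq_Icc).symm
    _ = ∫⁻ p in Set.Ioc 0 S.Pu, ENNReal.ofReal (S.q n v ^ (2 / α)) *
          ∫⁻ y in Set.Ioi ((S.q n v * S.ρ₀) ^ (-1 / α)), K y p := by
        refine setLIntegral_congr_fun measurableSet_Ioc fun p hp => ?_
        have h2 : ∀ r, ENNReal.ofReal (r * w r) * (ENNReal.ofReal (S.fP p) * G v r p)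
            = ENNReal.ofReal (S.fP p) * (ENNReal.ofReal (r * w r) * G v r p) := fun r =>
          mul_left_comm _ _ _
        have h3 : Measurable fun r => ENNReal.ofReal (r * w r) * G v r p :=
          hrw.mul ((hG v).comp measurable_prodMk_right)
        simp_rw [h2]
        rw [lintegral_const_mul _ h3, S.lintegral_radial_substitution hα hq hp.1 hw,
          ← lintegral_const_mul' _ _ ENNReal.ofReal_ne_top,
          ← lintegral_const_mul' _ _ ENNReal.ofReal_ne_top]
        refine lintegral_congr fun y => ?_
        simp only [K]
        rw [← ENNReal.ofReal_mul (S.fP_nonneg hp.1.le),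
          ← ENNReal.ofReal_mul (Real.rpow_nonneg hq.le _), Real.mul_rpow hq.le hp.1.le (z := 2 / α)]
        congr 1
        ring
    _ = ENNReal.ofReal (S.q n v ^ (2 / α)) * ∫⁻ p in Set.Ioc 0 S.Pu,
          ∫⁻ y in Set.Ioi ((S.q n v * S.ρ₀) ^ (-1 / α)), K y p :=
        lintegral_const_mul' _ _ ENNReal.ofReal_ne_top
    _ = ENNReal.ofReal (S.q n v ^ (2 / α)) *
          ∫⁻ y in Set.Ioi ((S.q n v * S.ρ₀) ^ (-1 / α)), ∫⁻ p in Set.Icc 0 S.Pu, K y p := by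
        rw [setLIntegral_congr Ioc_ae_eq_Icc, lintegral_lintegral_swap hK.aemeasurable]

/-! ### Finiteness of the double integrals -/

/-- The radial form of the integral is at most `∫ r e^{-β r} dr`. -/
lemma interferenceSum_los_ne_top {n : ℕ} (hn : 1 ≤ n) {α : ℝ} (hα : 0 < α) :
    S.interferenceSum α (fun r => Real.exp (-S.β * r)) n ≠ ∞ := by
  let π : Measure ℝ :=
    (volume.restrict (Set.Icc 0 S.Pu)).withDensity (fun p => ENNReal.ofReal (S.fP p))
  have hπ : IsProbabilityMeasure π := ⟨by
    rw [withDensity_apply _ MeasurableSet.univ, Measure.restrict_univ, S.lintegral_fP]⟩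
  rw [← S.lintegral_received_eq_interferenceSum (π := π) rfl hα (by fun_prop)
    (fun r _ => (Real.exp_pos _).le) hn]
  have hint : IntegrableOn (fun r : ℝ => r * Real.exp (-S.β * r)) (Set.Ioi 0) := by
    have := integrableOn_rpow_mul_exp_neg_mul_rpow (s := 1) (p := 1) (b := S.β)
      (by norm_num) one_pos S.β_pos
    simpa using this
  refine ne_top_of_le_ne_top (b := ∫⁻ r in Set.Ioi (0 : ℝ),
    ENNReal.ofReal (r * Real.exp (-S.β * r))) ?_ (lintegral_mono fun r => ?_)
  · exact hint.lintegral_lt_top.ne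
  · refine mul_le_of_le_one_right' ?_
    calc _ ≤ ∫⁻ _, 1 ∂(π.prod (S.gainLaw.prod S.fadingLaw)) :=
          lintegral_mono fun m => tsub_le_self
      _ = 1 := by simp

/-- For `α > 2` the bound `ℱ(N, y / N) ≤ y` makes the integral over `y` converge. -/
lemma interferenceSum_ne_top {n : ℕ} (hn : 1 ≤ n) {α : ℝ} (hα : 2 < α) {w : ℝ → ℝ}
    (hw : ∀ r, 0 ≤ r → w r ∈ Set.Icc (0 : ℝ) 1) : S.interferenceSum α w n ≠ ∞ := by
  refine ENNReal.sum_ne_top.2 fun v _ => ENNReal.mul_ne_top ENNReal.ofReal_ne_top ?_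
  have hα0 : 0 < α := by linarith
  have hq := S.q_pos hn v
  have hA : 0 < (S.q n v * S.ρ₀) ^ (-1 / α) := Real.rpow_pos_of_pos (mul_pos hq S.ρ₀_pos) _
  have hN := S.N_cast_pos
  have hPu := Real.rpow_nonneg S.Pu_pos.le (2 / α)
  refine ne_top_of_le_ne_top (b := ∫⁻ y in Set.Ioi ((S.q n v * S.ρ₀) ^ (-1 / α)),
    ENNReal.ofReal (y ^ (1 - α)) * ENNReal.ofReal (S.Pu ^ (2 / α))) ?_
    (setLIntegral_mono' measurableSet_Ioi fun y hy => ?_)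
  · rw [lintegral_mul_const' _ _ ENNReal.ofReal_ne_top]
    have hint : IntegrableOn (fun y : ℝ => y ^ (1 - α))
        (Set.Ioi ((S.q n v * S.ρ₀) ^ (-1 / α))) :=
      integrableOn_Ioi_rpow_of_lt (by linarith) hA
    exact ENNReal.mul_ne_top hint.lintegral_lt_top.ne ENNReal.ofReal_ne_top
  · have hy0 : 0 < y := hA.trans hy
    have hyα : 0 ≤ y ^ (-α) / S.N := by positivity
    calc ∫⁻ p in Set.Icc 0 S.Pu, ENNReal.ofReal (calF S.N (y ^ (-α) / S.N)
          * w ((S.q n v * p) ^ (1 / α) * y) * y * p ^ (2 / α) * S.fP p)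
        ≤ ∫⁻ p in Set.Icc 0 S.Pu, ENNReal.ofReal (y ^ (1 - α)) * ENNReal.ofReal (S.Pu ^ (2 / α))
            * ENNReal.ofReal (S.fP p) := by
          refine setLIntegral_mono' measurableSet_Icc fun p hp => ?_
          have hw' := hw ((S.q n v * p) ^ (1 / α) * y)
            (mul_nonneg (Real.rpow_nonneg (mul_nonneg hq.le hp.1) _) hy0.le)
          have hfp := S.fP_nonneg hp.1
          have hp2 := Real.rpow_nonneg hp.1 (2 / α)
          rw [← ENNReal.ofReal_mul (by positivity), ← ENNReal.ofReal_mul (by positivity)]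
          refine ENNReal.ofReal_le_ofReal (mul_le_mul_of_nonneg_right ?_ hfp)
          have hF : calF S.N (y ^ (-α) / S.N) ≤ y ^ (-α) := by
            have := calF_le S.N hyα
            rwa [mul_div_cancel₀ _ hN.ne'] at this
          have hF0 := calF_nonneg S.N hyα
          have h1 : calF S.N (y ^ (-α) / S.N) * w ((S.q n v * p) ^ (1 / α) * y) ≤ y ^ (-α) :=
            (mul_le_of_le_one_right hF0 hw'.2).trans hF
          have h2 : y ^ (1 - α) = y ^ (-α) * y := by
            rw [← Real.rpow_add_one hy0.ne']
            congr 1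
            ring
          rw [h2]
          exact mul_le_mul (mul_le_mul_of_nonneg_right h1 hy0.le)
            (Real.rpow_le_rpow hp.1 hp.2 (by positivity)) hp2 (by positivity)
      _ = ENNReal.ofReal (y ^ (1 - α)) * ENNReal.ofReal (S.Pu ^ (2 / α)) := by
          rw [lintegral_const_mul' _ _ (ENNReal.mul_ne_top ENNReal.ofReal_ne_top
            ENNReal.ofReal_ne_top), S.lintegral_fP, mul_one]

lemma Q_ne_top {n : ℕ} (hn : 1 ≤ n) : S.Q n ≠ ∞ := by
  rw [Q_eq]
  exact ENNReal.mul_ne_top ENNReal.ofReal_ne_top (S.interferenceSum_los_ne_top hn S.αL_pos)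

lemma V_ne_top {n : ℕ} (hn : 1 ≤ n) (hα : 2 < S.αN) : S.V n ≠ ∞ := by
  rw [V_eq]
  refine ENNReal.mul_ne_top ENNReal.ofReal_ne_top (S.interferenceSum_ne_top hn hα fun r hr => ?_)
  have := S.exp_neg_mem_Icc hr
  exact ⟨by linarith [this.2], by linarith [this.1]⟩

/-! ### The outage probability under Alzer's approximation -/

/-- The intensity integral in the Laplace functional of the interference. -/
lemma lintegral_plane_interfererTerm {π : Measure ℝ} [IsProbabilityMeasure π]
    (hπ : π = (volume.restrict (Set.Icc 0 S.Pu)).withDensity (fun p => ENNReal.ofReal (S.fP p)))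
    {n : ℕ} (hn : 1 ≤ n) :
    ENNReal.ofReal S.lam * ∫⁻ x, ∫⁻ z,
        (1 - eexp (ENNReal.ofReal (S.eta * n * S.θ / (S.ρ₀ * S.gain)) * S.interfererTerm x z))
          ∂(unifLaw.prod (π.prod (S.gainLaw.prod S.fadingLaw)))
      = S.Q n + S.V n := by
  have hsub : Measurable fun y : ℝ≥0∞ => 1 - eexp y := measurable_const.sub measurable_eexp
  set s := ENNReal.ofReal (S.eta * n * S.θ / (S.ρ₀ * S.gain)) with hs
  let A : ℝ → ℝ → ℝ≥0∞ := fun α r =>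
    ∫⁻ m, (1 - eexp (s * S.received α r m)) ∂(π.prod (S.gainLaw.prod S.fadingLaw))
  have hA : ∀ α, Measurable (A α) := fun α =>
    (hsub.comp ((S.measurable_received α).const_mul s)).lintegral_prod_right'
  have h1 : ∀ x : Plane, ∫⁻ z, (1 - eexp (s * S.interfererTerm x z))
        ∂(unifLaw.prod (π.prod (S.gainLaw.prod S.fadingLaw)))
      = ∫⁻ u, (if u ≤ Real.exp (-S.β * ‖x‖) then A S.αL ‖x‖ else A S.αN ‖x‖) ∂unifLaw := by
    intro x
    have hm : Measurable fun z => 1 - eexp (s * S.interfererTerm x z) :=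
      hsub.comp ((S.measurable_interfererTerm.comp measurable_prodMk_left).const_mul s)
    rw [lintegral_prod _ hm.aemeasurable]
    refine lintegral_congr fun u => ?_
    simp only [interfererTerm, A]
    split_ifs <;> rfl
  simp_rw [h1]
  rw [S.lintegral_plane_los (hA _) (hA _),
    S.lintegral_received_eq_interferenceSum hπ S.αL_pos (by fun_prop)
      (fun r _ => (Real.exp_pos _).le) hn,
    S.lintegral_received_eq_interferenceSum hπ S.αN_pos
      (w := fun r => 1 - Real.exp (-S.β * r)) (by fun_prop)
      (fun r hr => sub_nonneg.2 (S.exp_neg_mem_Icc hr).2) hn,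
    ← mul_assoc, ← ENNReal.ofReal_mul S.lam_pos.le, mul_comm S.lam, mul_add, ← Q_eq, ← V_eq]

variable {Ω : Type*} [MeasurableSpace Ω] {μ : Measure Ω} [IsProbabilityMeasure μ]
  {π : Measure ℝ} [IsProbabilityMeasure π] {X : ℕ → Ω → Plane} {M : Marks Ω} {h₀ : Ω → ℝ}

/-- The Laplace transform of the level. -/
lemma lintegral_eexp_level (hX : S.IsUplink π h₀ X M μ)
    (hπ : π = (volume.restrict (Set.Icc 0 S.Pu)).withDensity (fun p => ENNReal.ofReal (S.fP p)))
    {n : ℕ} (hn : 1 ≤ n) :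
    ∫⁻ ω, eexp (n * (ENNReal.ofReal S.eta * S.level X M ω)) ∂μ
      = eexp (ENNReal.ofReal (S.eta * n * S.θ * S.σsq / (S.ρ₀ * S.gain)) + S.Q n + S.V n) := by
  have hη := S.eta_pos
  have hθ := S.θ_pos
  have hg := S.gain_pos
  have hρ := S.ρ₀_pos
  set s := S.eta * n * S.θ / (S.ρ₀ * S.gain) with hs
  have hs0 : 0 ≤ s := by positivity
  have h1 : ∀ ω, (n : ℝ≥0∞) * (ENNReal.ofReal S.eta * S.level X M ω)
      = ENNReal.ofReal (S.eta * n * S.θ * S.σsq / (S.ρ₀ * S.gain))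
        + ∑' i, ENNReal.ofReal s * S.interfererTerm (X i ω) (M.tuple i ω) := by
    intro ω
    have e1 : (n : ℝ≥0∞) * (ENNReal.ofReal S.eta * ENNReal.ofReal (S.θ / (S.ρ₀ * S.gain)))
        = ENNReal.ofReal s := by
      rw [← ENNReal.ofReal_natCast, ← ENNReal.ofReal_mul hη.le,
        ← ENNReal.ofReal_mul (Nat.cast_nonneg n), hs]
      congr 1
      ring
    rw [level, disturbance_eq, ← mul_assoc (ENNReal.ofReal S.eta), ← mul_assoc (n : ℝ≥0∞), e1,
      mul_add, ← ENNReal.ofReal_mul hs0, ENNReal.tsum_mul_left, hs]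
    congr 2
    ring
  simp_rw [h1, eexp_add]
  have hf : Measurable (Function.uncurry fun x z => ENNReal.ofReal s * S.interfererTerm x z) :=
    S.measurable_interfererTerm.const_mul _
  have hE : Measurable fun ω =>
      eexp (∑' i, ENNReal.ofReal s * S.interfererTerm (X i ω) (M.tuple i ω)) :=
    measurable_eexp.comp (Measurable.tsum fun i =>
      hf.comp ((hX.poisson.measurable i).prodMk (hX.mark_measurable i)))
  rw [lintegral_const_mul _ hE, hX.poisson.lintegral_eexp_tsum_marked hX.mark_measurable
    hX.mark_law hX.mark_indep hX.indep hf, S.lintegral_plane_interfererTerm hπ hn, eexp_add,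
    ← mul_assoc]

/-- The binomial theorem reduces the outage probability under Alzer's approximation to the
Laplace transform of the level. -/
lemma outage_alzerCDF (hX : S.IsUplink π h₀ X M μ)
    (hπ : π = (volume.restrict (Set.Icc 0 S.Pu)).withDensity (fun p => ENNReal.ofReal (S.fP p))) :
    S.outage S.alzerCDF X M μ
      = 1 - ∑ n ∈ Finset.Icc 1 S.N, (-1 : ℝ) ^ (n + 1) * (S.N.choose n : ℝ)
          * expNeg (ENNReal.ofReal (S.eta * n * S.θ * S.σsq / (S.ρ₀ * S.gain))
              + S.Q n + S.V n) := by
  let E : ℕ → Ω → ℝ≥0∞ := fun n ω => eexp (n * (ENNReal.ofReal S.eta * S.level X M ω))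
  have hEm : ∀ n, Measurable (E n) := fun n =>
    measurable_eexp.comp (((S.measurable_level hX).const_mul _).const_mul _)
  have hElt : ∀ n ω, E n ω < ∞ := fun n ω => (eexp_le_one _).trans_lt ENNReal.one_lt_top
  have hEint : ∀ n, Integrable (fun ω => (E n ω).toReal) μ := fun n =>
    integrable_toReal_of_lintegral_ne_top (hEm n).aemeasurable
      ((lintegral_mono fun ω => eexp_le_one _).trans_lt (by simp)).ne
  have hpt : ∀ ω, S.alzerCDF (S.level X M ω)
      = ∑ n ∈ Finset.range (S.N + 1), (-1 : ℝ) ^ n * (S.N.choose n : ℝ) * (E n ω).toReal := by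
    intro ω
    rw [alzerCDF, ← toReal_eexp, sub_eq_neg_add, add_pow]
    refine Finset.sum_congr rfl fun n _ => ?_
    simp only [E]
    rw [eexp_natCast_mul, ENNReal.toReal_pow, one_pow, neg_pow]
    ring
  have hint : ∀ n, ∫ ω, (E n ω).toReal ∂μ = (∫⁻ ω, E n ω ∂μ).toReal := fun n =>
    integral_toReal (hEm n).aemeasurable (ae_of_all _ (hElt n))
  rw [outage]
  simp_rw [hpt]
  rw [integral_finsetSum _ fun n _ => (hEint n).const_mul _]
  simp_rw [integral_const_mul, hint]
  rw [Finset.range_eq_Ico, Finset.sum_eq_sum_Ico_succ_bot (Nat.succ_pos _), sub_eq_add_neg,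
    ← Finset.sum_neg_distrib]
  congr 1
  · simp [E]
  · refine Finset.sum_congr (by ext; simp) fun n hn => ?_
    have hn1 : 1 ≤ n := (Finset.mem_Icc.1 hn).1
    simp only [E]
    rw [S.lintegral_eexp_level hX hπ hn1, toReal_eexp, pow_succ]
    ring

end Params

end MmWave

theorem theorem2 (S : MmWave.Params)
    -- the base stations seen from a typical user, which determine its transmit power
    {Ω₀ : Type*} [MeasurableSpace Ω₀] (μ₀ : Measure Ω₀) [IsProbabilityMeasure μ₀]
    (Y : ℕ → Ω₀ → MmWave.Plane) (V : ℕ → Ω₀ → ℝ) (hY : S.IsBSNetwork Y V μ₀)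
    -- the uplink at the reference base station
    {Ω : Type*} [MeasurableSpace Ω] (μ : Measure Ω) [IsProbabilityMeasure μ]
    (h₀ : Ω → ℝ) (X : ℕ → Ω → MmWave.Plane) (M : MmWave.Params.Marks Ω)
    (hX : S.IsUplink (S.powerLaw Y V μ₀) h₀ X M μ) :
    -- `f_P` is the density of the transmit power on `[0, Pu]`
    S.powerLaw Y V μ₀
        = (volume.restrict (Set.Icc 0 S.Pu)).withDensity (fun p => ENNReal.ofReal (S.fP p)) ∧
    -- the outage probability before the approximation of the fading distribution
    μ.real {ω | S.SINR h₀ X M ω < ENNReal.ofReal S.θ} = S.outage S.fadingCDF X M μ ∧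
    μ.real {ω | S.SINR h₀ X M ω ≤ ENNReal.ofReal S.θ} = S.outage S.fadingCDF X M μ ∧
    -- the outage probability with that approximation
    S.outage S.alzerCDF X M μ
        = 1 - ∑ n ∈ Finset.Icc 1 S.N, (-1 : ℝ) ^ (n + 1) * (S.N.choose n : ℝ)
            * MmWave.expNeg (ENNReal.ofReal (S.eta * n * S.θ * S.σsq / (S.ρ₀ * S.gain))
                + S.Q n + S.V n) ∧
    -- finiteness of the double integrals
    (∀ n ∈ Finset.Icc 1 S.N, S.Q n ≠ ∞) ∧
    (2 < S.αN → ∀ n ∈ Finset.Icc 1 S.N, S.V n ≠ ∞) := by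
  have hπ := S.powerLaw_eq_withDensity hY
  have := S.isProbabilityMeasure_powerLaw hY
  exact ⟨hπ, S.measureReal_SINR_lt hX, S.measureReal_SINR_le hX, S.outage_alzerCDF hX hπ,
    fun n hn => S.Q_ne_top (Finset.mem_Icc.1 hn).1,
    fun hα n hn => S.V_ne_top (Finset.mem_Icc.1 hn).1 hα⟩
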